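/- Let $d\ge 1$, $0<\alpha\le 1$ and $M>0$. An environment consists of functions $f:[0,1]^d\to\mathbb R$ and $s:[0,1]^d\to[0,\infty)$ and, for every $x$, a noise law $\nu_x$ (depending measurably on $x$) with mean $0$ and variance $1$; a query at $x$ returns $f(x)+s(x)\varepsilon$ with $\varepsilon\sim\nu_x$ drawn independently. Let $\mathcal E$ be the set of environments in which $f$ and $s$ are $(M,\alpha)$-Hölder, i.e. $|g(x)-g(y)|\le M\|x-y\|_2^\alpha$ on $[0,1]^d$ for $g\in\{f,s\}$, and let $\mathcal E_{[0,1]}\subseteq\mathcal E$ be the set of those in which moreover every observation lies in $[0,1]$ almost surely. An algorithm $\mathcal A$ first fixes a partition (up to null sets) of $[0,1]^d$ into finitely many convex strata $\Omega_1,\dots,\Omega_K$ of positive measure and of the same shape (their closures are images of each other under similarities of $\mathbb R^d$); $K$ and the partition may depend on $n$. In each round $t=1,\dots,n$ it selects, possibly at random and depending on the previous rounds (selected strata, sampled points, observations), a stratum $\Omega_{k_t}$, and queries a point drawn uniformly from $\Omega_{k_t}$. Write $w_k=|\Omega_k|$, $\mu_k=\frac1{w_k}\int_{\Omega_k}f(x)\,dx$,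 $\sigma_k^2=\frac1{w_k}\int_{\Omega_k}\mathbb E_{\varepsilon\sim\nu_x}\big[(f(x)+s(x)\varepsilon-\mu_k)^2\big]dx$, let $T_{k,n}$ be the number of rounds $t\le n$ with $k_t=k$, and let $$L_n(\mathcal A)=\sum_{k\le K}\frac{w_k^2\sigma_k^2}{T_{k,n}}\in[0,\infty]$$ be the pseudo-risk (a term with $T_{k,n}=0$ is $\infty$ if $\sigma_k>0$ and $0$ if $\sigma_k=0$). Then there is a constant $c>0$, depending only on $d,\alpha,M$, such that for every integer $n\ge 1$ $$\inf_{\mathcal A}\ \sup_{(f,s,\nu)\in\mathcal E}\Big(\mathbb E\,L_n(\mathcal A)-\frac1n\Big(\int_{[0,1]^d}s(x)\,dx\Big)^2\Big)\ \ge\ c\,n^{-\frac{d+4\alpha}{d+3\alpha}},$$ where the infimum is over all such algorithms. The same bound holds if the supremum is restricted to $\mathcal E_{[0,1]}$. -/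

import Mathlib

open MeasureTheory ProbabilityTheory
open scoped NNReal ENNReal

noncomputable section

namespace StratifiedSampling

/-- Points of `ℝ^d`, with the Euclidean norm and Lebesgue measure. -/
abbrev Point (d : ℕ) : Type := EuclideanSpace ℝ (Fin d)

/-- The domain `[0,1]^d`. -/
def unitCube (d : ℕ) : Set (Point d) := {x | ∀ i, x i ∈ Set.Icc (0 : ℝ) 1}

/-- An environment: a function `f`, a noise level `s ≥ 0`, and for every point `x` a noise law `ν x`
with mean `0` and variance `1`. A query at `x` returns `f x + s x * ε` with `ε` drawn from `ν x`.
The values of `f`, `s` and `ν` outside `[0,1]^d` play no role. -/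
structure Environment (d : ℕ) where
  f : Point d → ℝ
  s : Point d → ℝ
  ν : Kernel (Point d) ℝ
  measurable_f : Measurable f
  measurable_s : Measurable s
  s_nonneg : ∀ x ∈ unitCube d, 0 ≤ s x
  isMarkov : IsMarkovKernel ν
  memLp_noise : ∀ x, MemLp (fun ε : ℝ => ε) 2 (ν x)
  noise_mean : ∀ x, ∫ ε, ε ∂(ν x) = 0
  noise_variance : ∀ x, ∫ ε, ε ^ 2 ∂(ν x) = 1

/-- The environments whose functions `f` and `s` are `(M, α)`-Hölder continuous on `[0,1]^d`. -/
def holderEnvironments (d : ℕ) (α M : ℝ≥0) : Set (Environment d) :=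
  {e | HolderOnWith M α e.f (unitCube d) ∧ HolderOnWith M α e.s (unitCube d)}

/-- The environments in which every observation lies in `[0,1]` almost surely. -/
def boundedEnvironments (d : ℕ) : Set (Environment d) :=
  {e | ∀ x ∈ unitCube d, ∀ᵐ ε ∂(e.ν x), e.f x + e.s x * ε ∈ Set.Icc (0 : ℝ) 1}

/-- The law of the noisy observation `f x + s x * ε`, as a function of the queried point `x`. -/
def Environment.obs {d : ℕ} (e : Environment d) : Kernel (Point d) ℝ :=
  (Kernel.id ×ₖ e.ν).map (fun p : Point d × ℝ => e.f p.1 + e.s p.1 * p.2)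

/-- What is recorded in one round: the selected stratum, the sampled point, the observation. -/
abbrev Round (d K : ℕ) : Type := Fin K × Point d × ℝ

/-- The record of the first `t` rounds. -/
abbrev History (d K t : ℕ) : Type := Fin t → Round d K

/-- An online stratified sampling algorithm on `[0,1]^d` with convex strata of the same shape.
Strata may overlap in null sets only; convex sets are automatically Lebesgue measurable. Strata have
the same shape if their closures are images of each other under similarities of `ℝ^d`: closures are
taken so that half-open and closed cubes have the same shape.
The (possibly randomized) policy selects the stratum of round `t + 1` from the first `t` rounds. -/
structure Algorithm (d : ℕ) where
  K : ℕ
  stratum : Fin K → Set (Point d)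
  convex : ∀ k, Convex ℝ (stratum k)
  volume_pos : ∀ k, 0 < volume (stratum k)
  disjoint : Pairwise fun k l => AEDisjoint volume (stratum k) (stratum l)
  iUnion_eq : ⋃ k, stratum k = unitCube d
  same_shape : ∀ k l, ∃ φ : Point d ≃ᵈ Point d, φ '' closure (stratum k) = closure (stratum l)
  policy : (t : ℕ) → Kernel (History d K t) (Fin K)
  isMarkov : ∀ t, IsMarkovKernel (policy t)

attribute [instance] Environment.isMarkov Algorithm.isMarkov

variable {d : ℕ}

namespace Algorithm

/-- The measure `w_k` of stratum `k`. -/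
def w (A : Algorithm d) (k : Fin A.K) : ℝ := volume.real (A.stratum k)

/-- The mean `μ_k` of `f` on stratum `k`. -/
def mean (A : Algorithm d) (e : Environment d) (k : Fin A.K) : ℝ :=
  (1 / A.w k) * ∫ x in A.stratum k, e.f x

/-- The variance `σ_k ^ 2` of an observation at a uniform point of stratum `k`. -/
def variance (A : Algorithm d) (e : Environment d) (k : Fin A.K) : ℝ :=
  (1 / A.w k) * ∫ x in A.stratum k, ∫ ε, (e.f x + e.s x * ε - A.mean e k) ^ 2 ∂(e.ν x)

/-- The joint law of a uniform point of stratum `k` and of the observation there. -/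
def sampleLaw (A : Algorithm d) (e : Environment d) : Kernel (Fin A.K) (Point d × ℝ) :=
  Kernel.ofFunOfCountable fun k => (volume[|A.stratum k]) ⊗ₘ e.obs

/-- The law of round `t + 1` given the first `t` rounds: the policy selects a stratum `k`, then a
uniform point of that stratum is queried. -/
def roundLaw (A : Algorithm d) (e : Environment d) (t : ℕ) :
    Kernel (History d A.K t) (Round d A.K) :=
  A.policy t ⊗ₖ Kernel.prodMkLeft (History d A.K t) (A.sampleLaw e)

/-- The law of the first `t` rounds of the algorithm in the environment `e`. -/
def historyLaw (A : Algorithm d) (e : Environment d) : (t : ℕ) → Measure (History d A.K t)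
  | 0 => Measure.dirac Fin.elim0
  | t + 1 => (A.historyLaw e t ⊗ₘ A.roundLaw e t).map
      fun p => (Fin.snoc p.1 p.2 : History d A.K (t + 1))

/-- The number `T_{k,n}` of samples in stratum `k` during `n` rounds. -/
def pulls (A : Algorithm d) {n : ℕ} (h : History d A.K n) (k : Fin A.K) : ℕ :=
  (Finset.univ.filter fun t => (h t).1 = k).card

/-- The pseudo-risk `∑_k w_k ^ 2 σ_k ^ 2 / T_{k,n}`, with values in `[0, ∞]`: it is infinite if a
stratum with `σ_k > 0` is never sampled; a stratum with `σ_k = 0` contributes `0`. -/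
def pseudoRisk (A : Algorithm d) (e : Environment d) {n : ℕ} (h : History d A.K n) : ℝ≥0∞ :=
  ∑ k, ENNReal.ofReal (A.w k ^ 2 * A.variance e k) / (A.pulls h k : ℝ≥0∞)

/-- The expected pseudo-risk `E L_n(A)` with budget `n`. -/
def expectedPseudoRisk (A : Algorithm d) (e : Environment d) (n : ℕ) : ℝ≥0∞ :=
  ∫⁻ h, A.pseudoRisk e h ∂(A.historyLaw e n)

/-- The excess `E L_n(A) - (1/n) (∫_{[0,1]^d} s)^2`. -/
def excess (A : Algorithm d) (e : Environment d) (n : ℕ) : EReal :=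
  (A.expectedPseudoRisk e n : EReal) -
    (((1 / (n : ℝ)) * (∫ x in unitCube d, e.s x) ^ 2 : ℝ) : EReal)

end Algorithm

/-- The minimax excess with budget `n` over a class of environments. -/
def minimaxExcess (d n : ℕ) (𝓔 : Set (Environment d)) : EReal :=
  ⨅ A : Algorithm d, ⨆ e ∈ 𝓔, A.excess e n

end StratifiedSampling

end

noncomputable section

namespace StratifiedSampling

variable {d : ℕ}

/-! Take `f = 1/2`, let `s` be a fixed ramp on the half `x i > 1/2` of the cube, and on the other
half add a bump of radius `ρ` and height of order `ρ ^ α` in each cell of an unknown subset `ξ` of a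
grid. There the noise is a rare event: it vanishes with probability `1 - u ^ 2`, where `u` is of
order `ρ ^ α`. A sample in a cell thus reveals a bump with probability at most `u ^ 2`. The oracle
gives a bump about `n * ρ ^ (d + α)` samples, so bumps stay undetected as long as `n * ρ ^ (d + 3 *
α)` is bounded.

Samples are charged a price `λ ^ 2`. By AM-GM, the risk of a set plus the price of its samples is at
least `2 * λ * ∫ s`, with equality for the sampling density `s / λ` (`two_mul_lintegral_le`). For
one cell, `two_point_bound` adds up this cost with the bump and the price paid without it. The total
exceeds the oracle value `2 * λ * Φ` by a fixed fraction, because an algorithm that cannot tell the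
two cases apart either undersamples the bump or wastes samples on its absence. The change of measure
is the one-sided domination `lintegral_mul_damping_le`: a history without large noise is nearly as
likely with the bump as without.

Averaging over all `ξ` (`exists_le_expectedPseudoRisk`) yields an environment whose surplus is of
order `λ * Φ` per cell. With about `ρ ^ (-d)` cells, `Φ` of order `ρ ^ (d + α)` and `λ` of order `1
/ n`, the excess is of order `ρ ^ α / n`; the choice `ρ ~ n ^ (-1 / (d + 3 * α))` gives the rate. -/

theorem measurableSet_unitCube (d : ℕ) : MeasurableSet (unitCube d) := by
  have : unitCube d = ⋂ i, (fun x : Point d => x i) ⁻¹' Set.Icc (0 : ℝ) 1 := by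
    ext x; simp [unitCube]
  rw [this]
  exact MeasurableSet.iInter fun i => measurableSet_Icc.preimage (by fun_prop)

theorem volume_unitCube (d : ℕ) : volume (unitCube d) = 1 := by
  have h := (EuclideanSpace.volume_preserving_symm_measurableEquiv_toLp (Fin d)).measure_preimage
    (s := Set.Icc (0 : Fin d → ℝ) 1) measurableSet_Icc.nullMeasurableSet
  have h2 : (MeasurableEquiv.toLp 2 (Fin d → ℝ)).symm ⁻¹' Set.Icc (0 : Fin d → ℝ) 1
      = unitCube d := by
    ext x
    simp only [Set.mem_preimage, Set.mem_Icc, Pi.le_def, unitCube, Set.mem_ofPred_eq]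
    exact ⟨fun h i => ⟨h.1 i, h.2 i⟩, fun h => ⟨fun i => (h i).1, fun i => (h i).2⟩⟩
  rw [← h2, h, Real.volume_Icc_pi]
  simp

theorem Environment.measurable_response (e : Environment d) :
    Measurable fun p : Point d × ℝ => e.f p.1 + e.s p.1 * p.2 :=
  (e.measurable_f.comp measurable_fst).add ((e.measurable_s.comp measurable_fst).mul measurable_snd)

instance (e : Environment d) : IsMarkovKernel e.obs :=
  Kernel.IsMarkovKernel.map _ e.measurable_response

theorem Environment.obs_apply (e : Environment d) (x : Point d) :
    e.obs x = (e.ν x).map fun ε => e.f x + e.s x * ε := by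
  rw [Environment.obs, Kernel.map_apply _ e.measurable_response, Kernel.prod_apply,
    Kernel.id_apply, Measure.dirac_prod, Measure.map_map e.measurable_response (by fun_prop)]
  rfl

/-! ### Laws of histories, and change of environment on a set. -/

namespace Algorithm

variable (A : Algorithm d) (e : Environment d)

theorem stratum_subset (k : Fin A.K) : A.stratum k ⊆ unitCube d :=
  A.iUnion_eq ▸ Set.subset_iUnion A.stratum k

theorem nullMeasurableSet_stratum (k : Fin A.K) : NullMeasurableSet (A.stratum k) volume :=
  (A.convex k).nullMeasurableSet volume

theorem volume_stratum_lt_top (k : Fin A.K) : volume (A.stratum k) < ∞ :=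
  (measure_mono (A.stratum_subset k)).trans_lt (by simp [volume_unitCube])

theorem sum_restrict_stratum :
    Measure.sum (fun k => volume.restrict (A.stratum k)) = volume.restrict (unitCube d) := by
  rw [← A.iUnion_eq, Measure.restrict_iUnion_ae A.disjoint A.nullMeasurableSet_stratum]

instance (k : Fin A.K) : IsProbabilityMeasure (volume[|A.stratum k]) :=
  cond_isProbabilityMeasure_of_finite (A.volume_pos k).ne' (A.volume_stratum_lt_top k).ne

instance : IsMarkovKernel (A.sampleLaw e) :=
  ⟨fun k => by
    change IsProbabilityMeasure ((volume[|A.stratum k]) ⊗ₘ e.obs)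
    infer_instance⟩

instance (t : ℕ) : IsMarkovKernel (A.roundLaw e t) := by
  unfold roundLaw; infer_instance

theorem measurable_snoc (t : ℕ) : Measurable fun p : History d A.K t × Round d A.K =>
    (Fin.snoc p.1 p.2 : History d A.K (t + 1)) := by
  refine measurable_pi_lambda _ fun i => ?_
  refine Fin.lastCases ?_ (fun j => ?_) i
  · simpa using measurable_snd
  · simpa [Function.comp_def] using (measurable_pi_apply j).comp measurable_fst

instance (t : ℕ) : IsProbabilityMeasure (A.historyLaw e t) := by
  induction t with
  | zero => unfold historyLaw; infer_instance
  | succ t ih =>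
    unfold historyLaw
    exact Measure.isProbabilityMeasure_map (A.measurable_snoc t).aemeasurable

/-- Expectations over the first `t + 1` rounds, by conditioning on the first `t` rounds. -/
theorem lintegral_historyLaw_succ (t : ℕ) {g : History d A.K (t + 1) → ℝ≥0∞} (hg : Measurable g) :
    ∫⁻ h, g h ∂(A.historyLaw e (t + 1)) =
      ∫⁻ h, ∫⁻ r, g (Fin.snoc h r : History d A.K (t + 1)) ∂(A.roundLaw e t h)
        ∂(A.historyLaw e t) := by
  rw [historyLaw, lintegral_map hg (A.measurable_snoc t),
    Measure.lintegral_compProd (f := fun p : History d A.K t × Round d A.K =>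
      g (Fin.snoc p.1 p.2)) (hg.comp (A.measurable_snoc t))]

theorem lintegral_roundLaw (t : ℕ) (h : History d A.K t) {g : Round d A.K → ℝ≥0∞}
    (hg : Measurable g) :
    ∫⁻ r, g r ∂(A.roundLaw e t h) =
      ∫⁻ k, ∫⁻ x, ∫⁻ y, g (k, x, y) ∂(e.obs x) ∂(volume[|A.stratum k]) ∂(A.policy t h) := by
  rw [roundLaw, Kernel.lintegral_compProd _ _ _ hg]
  refine lintegral_congr fun k => ?_
  have hk : Measurable fun p : Point d × ℝ => g (k, p) := hg.comp (by fun_prop)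
  change ∫⁻ p, g (k, p) ∂((volume[|A.stratum k]) ⊗ₘ e.obs) = _
  rw [Measure.lintegral_compProd hk]

/-- The number of sampled points that lie in `b`. -/
def visits (b : Set (Point d)) {t : ℕ} (h : History d A.K t) : ℝ≥0∞ :=
  ∑ i, b.indicator 1 (h i).2.1

open scoped Classical in
/-- The product over the rounds of a factor `r` for each sampled point that lies in `b`. -/
def damping (b : Set (Point d)) (r : ℝ≥0∞) {t : ℕ} (h : History d A.K t) : ℝ≥0∞ :=
  ∏ i, if (h i).2.1 ∈ b then r else 1

/-- The expected number of sampled points that lie in `b`, given the selected strata. -/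
def allocation (b : Set (Point d)) {t : ℕ} (h : History d A.K t) : ℝ≥0∞ :=
  ∑ k, (A.pulls h k : ℝ≥0∞) * (volume[|A.stratum k]) b

variable {A} {b : Set (Point d)} {r : ℝ≥0∞} {t : ℕ}

theorem pulls_eq_sum (h : History d A.K t) (k : Fin A.K) :
    (A.pulls h k : ℝ≥0∞) = ∑ i, ({k} : Set (Fin A.K)).indicator 1 (h i).1 := by
  classical
  simp only [pulls, Set.indicator_apply, Set.mem_singleton_iff, Pi.one_apply, Finset.sum_boole]

theorem measurable_pulls (k : Fin A.K) :
    Measurable fun h : History d A.K t => (A.pulls h k : ℝ≥0∞) := by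
  simp_rw [pulls_eq_sum]
  refine Finset.measurable_sum _ fun i _ => ?_
  exact (measurable_one.indicator (MeasurableSet.singleton k)).comp
    (measurable_fst.comp (measurable_pi_apply i))

theorem sum_pulls (h : History d A.K t) : ∑ k, A.pulls h k = t := by
  classical
  unfold pulls
  rw [← Finset.card_eq_sum_card_fiberwise (f := fun i => (h i).1) (t := Finset.univ)
    (by intro; simp)]
  simp

theorem measurable_visits (hb : MeasurableSet b) :
    Measurable fun h : History d A.K t => A.visits b h :=
  Finset.measurable_sum _ fun i _ => (measurable_one.indicator hb).comp
    (measurable_fst.comp (measurable_snd.comp (measurable_pi_apply i)))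

theorem measurable_damping (hb : MeasurableSet b) :
    Measurable fun h : History d A.K t => A.damping b r h := by
  classical
  exact Finset.measurable_prod _ fun i _ => Measurable.ite
    (hb.preimage (measurable_fst.comp (measurable_snd.comp (measurable_pi_apply i))))
    measurable_const measurable_const

theorem measurable_allocation : Measurable fun h : History d A.K t => A.allocation b h :=
  Finset.measurable_sum _ fun k _ => (measurable_pulls k).mul_const _

theorem visits_snoc (h : History d A.K t) (z : Round d A.K) :
    A.visits b (Fin.snoc h z : History d A.K (t + 1)) = A.visits b h + b.indicator 1 z.2.1 := by
  simp [visits, Fin.sum_univ_castSucc]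

open scoped Classical in
theorem damping_snoc (h : History d A.K t) (z : Round d A.K) :
    A.damping b r (Fin.snoc h z : History d A.K (t + 1)) =
      A.damping b r h * if z.2.1 ∈ b then r else 1 := by
  simp [damping, Fin.prod_univ_castSucc]

theorem allocation_snoc (h : History d A.K t) (z : Round d A.K) :
    A.allocation b (Fin.snoc h z : History d A.K (t + 1)) =
      A.allocation b h + (volume[|A.stratum z.1]) b := by
  classical
  simp only [allocation, pulls_eq_sum, Fin.sum_univ_castSucc, Fin.snoc_castSucc, Fin.snoc_last,
    add_mul, Finset.sum_add_distrib]
  simp [Set.indicator_apply]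

/-- The number of visits and the allocation of a set have the same expectation. -/
theorem lintegral_visits (hb : MeasurableSet b) (t : ℕ) :
    ∫⁻ h, A.visits b h ∂(A.historyLaw e t) = ∫⁻ h, A.allocation b h ∂(A.historyLaw e t) := by
  induction t with
  | zero => simp [visits, allocation, pulls]
  | succ t ih =>
    have hi : Measurable fun z : Round d A.K => b.indicator (1 : Point d → ℝ≥0∞) z.2.1 :=
      (measurable_one.indicator hb).comp (measurable_fst.comp measurable_snd)
    have hc : Measurable fun z : Round d A.K => (volume[|A.stratum z.1]) b :=
      (measurable_of_countable fun k => (volume[|A.stratum k]) b).comp measurable_fst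
    rw [lintegral_historyLaw_succ _ _ _ (measurable_visits hb),
      lintegral_historyLaw_succ _ _ _ measurable_allocation]
    simp_rw [visits_snoc, allocation_snoc]
    simp_rw [lintegral_add_left measurable_const]
    simp only [lintegral_const, measure_univ, mul_one]
    rw [lintegral_add_left (measurable_visits hb), lintegral_add_left measurable_allocation, ih]
    congr 1
    -- Given the selected stratum, the sampled point is uniform there, so the visit indicator has
    -- conditional mean equal to the increment of the allocation.
    refine lintegral_congr fun h => ?_
    rw [lintegral_roundLaw _ _ _ _ hi, lintegral_roundLaw _ _ _ _ hc]
    simp [lintegral_indicator_one hb]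

/-- If the observations in `e₁` dominate those in `e₀` up to a factor `r` on `b`, and agree with
them elsewhere, then so do the histories, up to a factor `r` for each visit of `b`. -/
theorem lintegral_mul_damping_le {e₀ e₁ : Environment d} (hb : MeasurableSet b)
    (hin : ∀ x ∈ b, r • e₀.obs x ≤ e₁.obs x) (hout : ∀ x ∉ b, e₀.obs x = e₁.obs x) (t : ℕ)
    {g : History d A.K t → ℝ≥0∞} (hg : Measurable g) :
    ∫⁻ h, g h * A.damping b r h ∂(A.historyLaw e₀ t) ≤ ∫⁻ h, g h ∂(A.historyLaw e₁ t) := by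
  classical
  induction t with
  | zero => simp [damping, historyLaw]
  | succ t ih =>
    have hs := A.measurable_snoc t
    have hr (h : History d A.K t) :
        Measurable fun z => g (Fin.snoc h z : History d A.K (t + 1)) :=
      hg.comp (hs.comp measurable_prodMk_left)
    have hpr : Measurable fun z : Round d A.K => if z.2.1 ∈ b then r else 1 :=
      Measurable.ite (hb.preimage (measurable_fst.comp measurable_snd))
        measurable_const measurable_const
    rw [lintegral_historyLaw_succ (g := fun h => g h * A.damping b r h) _ _ _
        (hg.mul (measurable_damping hb)),
      lintegral_historyLaw_succ _ _ _ hg]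
    -- The policy is common to both environments, so only the last observation has to be compared:
    -- its factor `r` pays for passing to `e₁`. What remains is a function of the first `t` rounds,
    -- to which the induction hypothesis applies.
    refine le_trans (lintegral_mono fun h => ?_) (ih ?_)
    · simp_rw [damping_snoc]
      calc
        _ = ∫⁻ z, (g (Fin.snoc h z : History d A.K (t + 1)) *
              (if z.2.1 ∈ b then r else 1)) * A.damping b r h
              ∂(A.roundLaw e₀ t h) := by
            congr 1; ext z; ring
        _ = (∫⁻ z, g (Fin.snoc h z : History d A.K (t + 1)) *
              (if z.2.1 ∈ b then r else 1)
              ∂(A.roundLaw e₀ t h)) * A.damping b r h :=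
            lintegral_mul_const _ ((hr h).mul hpr)
        _ ≤ _ := by
            refine mul_le_mul_left ?_ _
            rw [lintegral_roundLaw (g := fun z => g (Fin.snoc h z : History d A.K (t + 1)) *
                (if z.2.1 ∈ b then r else 1)) _ _ _ _ ((hr h).mul hpr),
              lintegral_roundLaw _ _ _ _ (hr h)]
            refine lintegral_mono fun k => lintegral_mono fun x => ?_
            have hy : Measurable fun y => g (Fin.snoc h (k, x, y) : History d A.K (t + 1)) :=
              (hr h).comp (by fun_prop)
            by_cases hx : x ∈ b
            · simp only [hx, if_true]
              rw [lintegral_mul_const _ hy]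
              rw [mul_comm, ← smul_eq_mul, ← lintegral_smul_measure]
              exact lintegral_mono' (hin x hx) le_rfl
            · simp [hx, hout x hx]
    · exact Measurable.lintegral_kernel_prod_right' (f := fun p : History d A.K t × Round d A.K =>
        g (Fin.snoc p.1 p.2 : History d A.K (t + 1))) (hg.comp hs)

/-- The Weierstrass inequality `∏ (1 - c i) ≥ 1 - ∑ c i`, written without subtraction. It bounds the
damping from below by a quantity linear in the number of visits. -/
theorem one_le_prod_add_sum {ι : Type*} (s : Finset ι) {a c : ι → ℝ≥0∞} (ha : ∀ i, a i ≤ 1)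
    (hac : ∀ i, 1 ≤ a i + c i) : 1 ≤ ∏ i ∈ s, a i + ∑ i ∈ s, c i := by
  classical
  induction s using Finset.induction_on with
  | empty => simp
  | insert i s hi ih =>
    rw [Finset.prod_insert hi, Finset.sum_insert hi]
    calc 1 ≤ a i + c i := hac i
      _ ≤ a i * (∏ i ∈ s, a i + ∑ i ∈ s, c i) + c i := by
        gcongr; exact le_mul_of_one_le_right' ih
      _ ≤ a i * ∏ i ∈ s, a i + 1 * ∑ i ∈ s, c i + c i := by
        rw [mul_add]; gcongr; exact ha i
      _ = _ := by ring

theorem damping_le_one (hr : r ≤ 1) (h : History d A.K t) : A.damping b r h ≤ 1 := by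
  classical
  refine Finset.prod_le_one' fun i _ => ?_
  by_cases hx : (h i).2.1 ∈ b <;> simp [hx, hr]

theorem one_le_damping_add {p : ℝ≥0∞} (hr : r ≤ 1) (hrp : 1 ≤ r + p) (h : History d A.K t) :
    1 ≤ A.damping b r h + p * A.visits b h := by
  classical
  rw [visits, Finset.mul_sum]
  refine one_le_prod_add_sum _ (fun i => ?_) fun i => ?_ <;>
  by_cases hx : (h i).2.1 ∈ b <;> simp [hx, hr, hrp]

end Algorithm

/-- AM-GM: after multiplication by `a * x`, the difference of the two sides is `(a * x * y - e) ^ 2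
+ (a * c - e ^ 2)`. The value `x = ∞` must be allowed, since it stands for a stratum without
samples. -/
theorem two_mul_le_add_inv {a c e : ℝ≥0} (ha : 0 < a) (hc : 0 < c) (h : e ^ 2 ≤ a * c)
    {x y : ℝ≥0∞} (hy : y ≠ ∞) : 2 * e * y ≤ a * (x * y ^ 2) + c * x⁻¹ := by
  rcases eq_or_ne x 0 with rfl | hx0
  · simp [ENNReal.mul_top, hc.ne']
  rcases eq_or_ne x ∞ with rfl | hx
  · rcases eq_or_ne y 0 with rfl | hy0
    · simp
    · simp [ENNReal.top_mul, ENNReal.mul_top, hy0, ha.ne']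
  lift x to ℝ≥0 using hx
  lift y to ℝ≥0 using hy
  have hx0 : x ≠ 0 := by exact_mod_cast hx0
  rw [← ENNReal.coe_inv hx0]
  norm_cast
  have hx1 : 0 < (x : ℝ) := by exact_mod_cast pos_iff_ne_zero.2 hx0
  have ha1 : 0 < (a : ℝ) := by exact_mod_cast ha
  have h1 : (e : ℝ) ^ 2 ≤ a * c := by exact_mod_cast h
  rw [← NNReal.coe_le_coe]
  push_cast
  have h2 : 0 ≤ (a : ℝ) * x * (a * (x * y ^ 2) + c * (x : ℝ)⁻¹ - 2 * e * y) := by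
    have : (a : ℝ) * x * (a * (x * y ^ 2) + c * (x : ℝ)⁻¹ - 2 * e * y) =
      (a * x * y - e) ^ 2 + (a * c - e ^ 2) := by field_simp; ring
    rw [this]
    have := sq_nonneg ((a : ℝ) * x * y - e)
    linarith
  have := nonneg_of_mul_nonneg_right h2 (mul_pos ha1 hx1)
  linarith

/-! ### Local risk, the price of samples, and the two-point bound. -/

namespace Algorithm

/-- The contribution of `b` to the pseudo-risk, for observations with standard deviation `σ x` at
the point `x`. -/
def localRisk (A : Algorithm d) (σ : Point d → ℝ≥0∞) (b : Set (Point d)) {t : ℕ}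
    (h : History d A.K t) : ℝ≥0∞ :=
  ∑ k, volume (A.stratum k) / A.pulls h k * ∫⁻ x in b, σ x ^ 2 ∂(volume.restrict (A.stratum k))

variable {A : Algorithm d} {b : Set (Point d)} {t : ℕ}

theorem measurable_localRisk (σ : Point d → ℝ≥0∞) :
    Measurable fun h : History d A.K t => A.localRisk σ b h :=
  Finset.measurable_sum _ fun k _ => (measurable_const.div (measurable_pulls k)).mul_const _

theorem localRisk_congr {σ τ : Point d → ℝ≥0∞} (hb : MeasurableSet b) (h : ∀ x ∈ b, σ x = τ x)
    (ω : History d A.K t) : A.localRisk σ b ω = A.localRisk τ b ω := by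
  refine Finset.sum_congr rfl fun k _ => ?_
  rw [setLIntegral_congr_fun hb fun x hx => by rw [h x hx]]

/-- For a constant regression function, the pseudo-risk is an integral of the squared noise. -/
theorem pseudoRisk_eq_localRisk {e : Environment d} {c C : ℝ} (hf : ∀ x, e.f x = c)
    (hs : ∀ x ∈ unitCube d, e.s x ≤ C) (ω : History d A.K t) :
    A.pseudoRisk e ω = A.localRisk (fun x => ENNReal.ofReal (e.s x)) Set.univ ω := by
  refine Finset.sum_congr rfl fun k _ => ?_
  have hw : A.w k ≠ 0 :=
    (ENNReal.toReal_pos (A.volume_pos k).ne' (A.volume_stratum_lt_top k).ne).ne'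
  have hmean : A.mean e k = c := by
    simp only [mean, hf, setIntegral_const, smul_eq_mul]
    change 1 / A.w k * (A.w k * c) = c
    field_simp
  have hinner (x : Point d) : ∫ ε, (e.f x + e.s x * ε - A.mean e k) ^ 2 ∂(e.ν x) = e.s x ^ 2 := by
    simp only [hmean, hf, add_sub_cancel_left, mul_pow]
    rw [integral_const_mul, e.noise_variance, mul_one]
  have hcube : ∀ᵐ x ∂(volume.restrict (A.stratum k)), x ∈ unitCube d :=
    ae_restrict_of_ae_restrict_of_subset (A.stratum_subset k)
      (ae_restrict_mem (measurableSet_unitCube d))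
  have hint : Integrable (fun x => e.s x ^ 2) (volume.restrict (A.stratum k)) := by
    have : IsFiniteMeasure (volume.restrict (A.stratum k)) :=
      ⟨by simpa using A.volume_stratum_lt_top k⟩
    refine Integrable.of_bound (e.measurable_s.pow_const 2).aestronglyMeasurable (C ^ 2) ?_
    filter_upwards [hcube] with x hx
    rw [Real.norm_of_nonneg (sq_nonneg _)]
    exact pow_le_pow_left₀ (e.s_nonneg x hx) (hs x hx) 2
  have hvar : A.w k ^ 2 * A.variance e k = A.w k * ∫ x in A.stratum k, e.s x ^ 2 := by
    simp only [variance, hinner]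
    field_simp
  have hw0 : 0 ≤ A.w k := measureReal_nonneg
  rw [hvar, ENNReal.ofReal_mul hw0, w,
    ofReal_measureReal (A.volume_stratum_lt_top k).ne,
    ofReal_integral_eq_lintegral_ofReal hint (ae_of_all _ fun x => sq_nonneg _),
    Measure.restrict_univ, div_eq_mul_inv, div_eq_mul_inv, mul_right_comm]
  congr 1
  refine lintegral_congr_ae ?_
  filter_upwards [hcube] with x hx
  rw [ENNReal.ofReal_pow (e.s_nonneg x hx)]

/-- Lagrangian form of the optimality of the oracle, with price `c` per sample. In each stratum
`x⁻¹` is the sampling density, and AM-GM is applied at each point of `b`. -/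
theorem two_mul_lintegral_le {a c e : ℝ≥0} (ha : 0 < a) (hc : 0 < c) (hac : e ^ 2 ≤ a * c)
    (hb : MeasurableSet b) (hbc : b ⊆ unitCube d) {ψ : Point d → ℝ≥0∞} (hψ : Measurable ψ)
    (hfin : ∀ x, ψ x ≠ ∞) (ω : History d A.K t) :
    2 * e * ∫⁻ x in b, ψ x ≤ a * A.localRisk ψ b ω + c * A.allocation b ω := by
  have hsum : ∫⁻ x in b, ψ x = ∑ k, ∫⁻ x in b, ψ x ∂(volume.restrict (A.stratum k)) := by
    rw [← Set.inter_eq_left.2 hbc, ← Measure.restrict_restrict hb, ← A.sum_restrict_stratum,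
      Measure.restrict_sum _ hb, lintegral_sum_measure, tsum_fintype, Set.inter_eq_left.2 hbc]
  rw [hsum, localRisk, allocation, Finset.mul_sum, Finset.mul_sum, Finset.mul_sum,
    ← Finset.sum_add_distrib]
  refine Finset.sum_le_sum fun k _ => ?_
  set x := volume (A.stratum k) / (A.pulls ω k : ℝ≥0∞) with hx
  have hx' : (A.pulls ω k : ℝ≥0∞) * (volume[|A.stratum k]) b =
      x⁻¹ * volume.restrict (A.stratum k) b := by
    rw [hx, ENNReal.inv_div (by simp) (by simp [(A.volume_pos k).ne']), ProbabilityTheory.cond,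
      Measure.smul_apply, smul_eq_mul, div_eq_mul_inv, mul_assoc]
  rw [hx', ← lintegral_const_mul _ hψ, ← lintegral_const_mul _ (hψ.pow_const 2), ← mul_assoc,
    ← setLIntegral_const, ← lintegral_const_mul _ (by fun_prop), ← lintegral_add_left (by fun_prop)]
  exact lintegral_mono fun y => two_mul_le_add_inv ha hc hac (hfin y)

/-- Allows disjoint sets to be treated separately: the risk is additive over them, and together they
use at most the `t` samples of the budget. -/
theorem sum_localRisk_add_le {ι : Type*} [Fintype ι] {D : ι → Set (Point d)}
    (hD : ∀ i, MeasurableSet (D i)) (hdisj : Pairwise fun i j => Disjoint (D i) (D j))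
    (σ : Point d → ℝ≥0∞) (c : ℝ≥0∞) (ω : History d A.K t) :
    ∑ i, (A.localRisk σ (D i) ω + c * A.allocation (D i) ω) ≤
      A.localRisk σ Set.univ ω + c * t := by
  rw [Finset.sum_add_distrib, ← Finset.mul_sum]
  gcongr
  · simp only [localRisk]
    rw [Finset.sum_comm]
    refine Finset.sum_le_sum fun k _ => ?_
    rw [← Finset.mul_sum]
    gcongr
    rw [← tsum_fintype (L := .unconditional ι), ← lintegral_iUnion hD hdisj]
    exact lintegral_mono_set (Set.subset_univ _)
  · simp only [allocation]
    rw [Finset.sum_comm]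
    calc _ ≤ ∑ k, (A.pulls ω k : ℝ≥0∞) * 1 := by
            refine Finset.sum_le_sum fun k _ => ?_
            rw [← Finset.mul_sum]
            gcongr
            rw [← tsum_fintype (L := .unconditional ι), ← measure_iUnion hdisj hD]
            exact prob_le_one
      _ = t := by simpa using congrArg (Nat.cast : ℕ → ℝ≥0∞) (sum_pulls ω)

/-- The two-point bound: an algorithm cannot both sample a set `b` enough when its noise is `ψ`
and avoid wasting samples on it when there is no noise. -/
theorem two_point_bound {e₀ e₁ : Environment d} {r p Φ : ℝ≥0∞} {lam : ℝ≥0} (hlam : 0 < lam)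
    (hb : MeasurableSet b) (hbc : b ⊆ unitCube d)
    (hin : ∀ x ∈ b, r • e₀.obs x ≤ e₁.obs x) (hout : ∀ x ∉ b, e₀.obs x = e₁.obs x)
    (hr : r ≤ 1) (hrp : 1 ≤ r + p) {ψ : Point d → ℝ≥0∞} (hψ : Measurable ψ)
    (hfin : ∀ x, ψ x ≠ ∞) (hΦ : ∫⁻ x in b, ψ x = Φ)
    (hsmall : 2 * (2 / 5 * lam : ℝ≥0) * Φ * p ≤ (lam ^ 2 / 2 : ℝ≥0)) (t : ℕ) :
    2 * (6 / 5 * lam : ℝ≥0) * Φ ≤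
      ∫⁻ ω, (A.localRisk ψ b ω + (lam ^ 2 : ℝ≥0) * A.allocation b ω) ∂(A.historyLaw e₁ t) +
      ∫⁻ ω, (lam ^ 2 : ℝ≥0) * A.allocation b ω ∂(A.historyLaw e₀ t) := by
  have hR : Measurable fun ω : History d A.K t => A.localRisk ψ b ω := measurable_localRisk ψ
  have hV : Measurable fun ω : History d A.K t => A.allocation b ω := measurable_allocation
  have hN : Measurable fun ω : History d A.K t => A.visits b ω := measurable_visits hb
  have hW : Measurable fun ω : History d A.K t => A.damping b r ω := measurable_damping hb
  -- The risk under `e₁` is split as `16/25 + 9/25`. The first share gives `4/5 = √(16/25)` here;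
  -- the second is compared with `e₀` below and gives `2/5`. The sum `6/5` exceeds the oracle value
  -- `1`.
  have h1 : 2 * (4 / 5 * lam : ℝ≥0) * Φ ≤ ∫⁻ ω, ((16 / 25 : ℝ≥0) * A.localRisk ψ b ω +
      (lam ^ 2 : ℝ≥0) * A.allocation b ω) ∂(A.historyLaw e₁ t) := by
    calc _ = ∫⁻ ω, 2 * (4 / 5 * lam : ℝ≥0) * Φ ∂(A.historyLaw e₁ t) := by simp
      _ ≤ _ := lintegral_mono fun ω => by
        rw [← hΦ]
        refine two_mul_lintegral_le (by positivity) (by positivity) ?_ hb hbc hψ hfin ω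
        exact le_of_eq (by ring)
  -- Half of the price `lam ^ 2` enters AM-GM, where `(2/5) ^ 2 ≤ (9/25) / 2`; the other half pays
  -- for the loss due to damping.
  have h2 : 2 * (2 / 5 * lam : ℝ≥0) * Φ ≤
      ∫⁻ ω, (9 / 25 : ℝ≥0) * A.localRisk ψ b ω * A.damping b r ω ∂(A.historyLaw e₀ t) +
      ∫⁻ ω, (lam ^ 2 : ℝ≥0) * A.allocation b ω ∂(A.historyLaw e₀ t) := by
    set C := 2 * (2 / 5 * lam : ℝ≥0) * Φ
    calc C = ∫⁻ ω, C ∂(A.historyLaw e₀ t) := by simp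
      _ ≤ ∫⁻ ω, ((9 / 25 : ℝ≥0) * A.localRisk ψ b ω * A.damping b r ω +
          (lam ^ 2 / 2 : ℝ≥0) * A.allocation b ω + C * p * A.visits b ω)
          ∂(A.historyLaw e₀ t) := by
        refine lintegral_mono fun ω => ?_
        have hpt : C ≤ (9 / 25 : ℝ≥0) * A.localRisk ψ b ω +
            (lam ^ 2 / 2 : ℝ≥0) * A.allocation b ω := by
          simp only [C]
          rw [← hΦ]
          refine two_mul_lintegral_le (by positivity) (by positivity) ?_ hb hbc hψ hfin ω
          rw [← NNReal.coe_le_coe]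
          push_cast
          nlinarith [sq_nonneg (lam : ℝ)]
        have hW1 : A.damping b r ω ≤ 1 := damping_le_one hr ω
        calc C ≤ C * (A.damping b r ω + p * A.visits b ω) :=
              le_mul_of_one_le_right' (one_le_damping_add hr hrp ω)
          _ = C * A.damping b r ω + C * p * A.visits b ω := by ring
          _ ≤ ((9 / 25 : ℝ≥0) * A.localRisk ψ b ω +
              (lam ^ 2 / 2 : ℝ≥0) * A.allocation b ω) * A.damping b r ω +
              C * p * A.visits b ω := by gcongr
          _ = (9 / 25 : ℝ≥0) * A.localRisk ψ b ω * A.damping b r ω +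
              (lam ^ 2 / 2 : ℝ≥0) * A.allocation b ω * A.damping b r ω +
              C * p * A.visits b ω := by ring
          _ ≤ _ := by
              gcongr ?_ + ?_ + _
              · exact le_rfl
              · exact mul_le_of_le_one_right' hW1
      _ = ∫⁻ ω, (9 / 25 : ℝ≥0) * A.localRisk ψ b ω * A.damping b r ω ∂(A.historyLaw e₀ t) +
          (lam ^ 2 / 2 : ℝ≥0) * ∫⁻ ω, A.allocation b ω ∂(A.historyLaw e₀ t) +
          C * p * ∫⁻ ω, A.allocation b ω ∂(A.historyLaw e₀ t) := by
        rw [lintegral_add_right _ (hN.const_mul _), lintegral_add_right _ (hV.const_mul _),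
          lintegral_const_mul _ hN, lintegral_const_mul _ hV, lintegral_visits e₀ hb]
      _ ≤ ∫⁻ ω, (9 / 25 : ℝ≥0) * A.localRisk ψ b ω * A.damping b r ω ∂(A.historyLaw e₀ t) +
          (lam ^ 2 / 2 : ℝ≥0) * ∫⁻ ω, A.allocation b ω ∂(A.historyLaw e₀ t) +
          (lam ^ 2 / 2 : ℝ≥0) * ∫⁻ ω, A.allocation b ω ∂(A.historyLaw e₀ t) := by
        -- By `hsmall`, the probability of detection costs at most the reserved half of the price
        -- per sample.
        gcongr
      _ = _ := by
        rw [lintegral_const_mul _ hV, add_assoc, ← add_mul, ← ENNReal.coe_add, add_halves]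
  have h3 := lintegral_mul_damping_le hb hin hout t (hR.const_mul ((9 / 25 : ℝ≥0) : ℝ≥0∞))
  calc 2 * (6 / 5 * lam : ℝ≥0) * Φ
      = 2 * (4 / 5 * lam : ℝ≥0) * Φ + 2 * (2 / 5 * lam : ℝ≥0) * Φ := by
        rw [← add_mul, ← mul_add, ← ENNReal.coe_add, ← add_mul]; norm_num
    _ ≤ ∫⁻ ω, ((16 / 25 : ℝ≥0) * A.localRisk ψ b ω +
          (lam ^ 2 : ℝ≥0) * A.allocation b ω) ∂(A.historyLaw e₁ t) +
        (∫⁻ ω, (9 / 25 : ℝ≥0) * A.localRisk ψ b ω ∂(A.historyLaw e₁ t) +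
          ∫⁻ ω, (lam ^ 2 : ℝ≥0) * A.allocation b ω ∂(A.historyLaw e₀ t)) := by
        gcongr
        exact h2.trans (by gcongr)
    _ = _ := by
        rw [← add_assoc, ← lintegral_add_right _ (hR.const_mul _)]
        congr 2
        ext ω
        rw [add_right_comm, ← add_mul, ← ENNReal.coe_add]
        norm_num

end Algorithm

/-! ### Averaging over the hypercube of environments. -/

theorem sum_le_sum_of_add_symmDiff_le {ι : Type*} [Fintype ι] [DecidableEq ι] (q : ι)
    {F G : Finset ι → ℝ≥0∞}
    (h : ∀ ξ, F ξ + F (symmDiff ξ {q}) ≤ G ξ + G (symmDiff ξ {q})) : ∑ ξ, F ξ ≤ ∑ ξ, G ξ := by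
  -- Flipping the cell `q` permutes the subsets, so summing over neighbouring pairs counts each
  -- subset twice.
  have hinv : Function.Involutive fun ξ : Finset ι => symmDiff ξ {q} :=
    fun ξ => symmDiff_symmDiff_cancel_right _ _
  have hsum (H : Finset ι → ℝ≥0∞) : ∑ ξ, (H ξ + H (symmDiff ξ {q})) = 2 * ∑ ξ, H ξ := by
    rw [Finset.sum_add_distrib, two_mul]
    exact congrArg _ (Equiv.sum_comp hinv.toPerm H)
  have := Finset.sum_le_sum fun ξ (_ : ξ ∈ Finset.univ) => h ξ
  rw [hsum, hsum] at this
  exact (ENNReal.mul_le_mul_iff_right two_ne_zero ENNReal.ofNat_ne_top).1 this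

/-- The sum of a two-point bound over all pairs of neighbours of the hypercube. -/
theorem sum_hypercube_le {ι : Type*} [Fintype ι] [DecidableEq ι] (q : ι) {K : ℝ≥0∞}
    {G : Finset ι → ℝ≥0∞} (h : ∀ ξ, q ∉ ξ → 12 * K ≤ G (insert q ξ) + G ξ) :
    ∑ ξ : Finset ι, (if q ∈ ξ then 11 * K else K) ≤ ∑ ξ, G ξ := by
  -- The split of `12` into `11 + 1` leaves the same surplus `K` with and without `q`, once the
  -- oracle cost `10 * K` of a bump that is present has been deducted.
  refine sum_le_sum_of_add_symmDiff_le q fun ξ => ?_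
  by_cases hq : q ∈ ξ
  · have h1 : symmDiff ξ {q} = ξ.erase q := by
      ext x; by_cases hx : x = q <;> simp [Finset.mem_symmDiff, hx, hq]
    have h2 := h (ξ.erase q) (by simp)
    rw [Finset.insert_erase hq] at h2
    rw [h1]
    simp only [hq, if_true, Finset.mem_erase, ne_eq, not_true, false_and, if_false]
    exact le_trans (le_of_eq (by ring)) h2
  · have h1 : symmDiff ξ {q} = insert q ξ := by
      ext x; by_cases hx : x = q <;> simp [Finset.mem_symmDiff, hx, hq]
    have h2 := h ξ hq
    rw [h1, add_comm (G ξ)]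
    simp only [hq, if_false, Finset.mem_insert_self, if_true]
    exact le_trans (le_of_eq (by ring)) h2

namespace Algorithm

/-- The lower bound over a hypercube of environments: in one of them the risk is at least the
one of the oracle allocation, plus a term that accounts for the uncertainty on all the cells. -/
theorem exists_le_expectedPseudoRisk (A : Algorithm d) {ι : Type*} [Fintype ι] [DecidableEq ι]
    (E : Finset ι → Environment d) {c C : ℝ} (hf : ∀ ξ x, (E ξ).f x = c)
    (hC : ∀ ξ, ∀ x ∈ unitCube d, (E ξ).s x ≤ C)
    {B : Set (Point d)} {D : ι → Set (Point d)} (hB : MeasurableSet B) (hBc : B ⊆ unitCube d)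
    (hD : ∀ q, MeasurableSet (D q)) (hDc : ∀ q, D q ⊆ unitCube d)
    (hBD : ∀ q, Disjoint B (D q)) (hDD : Pairwise fun q q' => Disjoint (D q) (D q'))
    {σ : Point d → ℝ≥0∞} {ψ : ι → Point d → ℝ≥0∞} (hσ : Measurable σ) (hσ' : ∀ x, σ x ≠ ∞)
    (hψ : ∀ q, Measurable (ψ q)) (hψ' : ∀ q x, ψ q x ≠ ∞)
    (hsB : ∀ ξ, ∀ x ∈ B, ENNReal.ofReal ((E ξ).s x) = σ x)
    (hsD : ∀ ξ, ∀ q ∈ ξ, ∀ x ∈ D q, ENNReal.ofReal ((E ξ).s x) = ψ q x)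
    {r p Φ : ℝ≥0∞} (hr : r ≤ 1) (hrp : 1 ≤ r + p) (hΦ : ∀ q, ∫⁻ x in D q, ψ q x = Φ)
    (hin : ∀ ξ, ∀ q ∉ ξ, ∀ x ∈ D q, r • (E ξ).obs x ≤ (E (insert q ξ)).obs x)
    (hout : ∀ ξ, ∀ q ∉ ξ, ∀ x ∉ D q, (E ξ).obs x = (E (insert q ξ)).obs x)
    {lam : ℝ≥0} (hlam : 0 < lam)
    (hsmall : 2 * (2 / 5 * lam : ℝ≥0) * Φ * p ≤ (lam ^ 2 / 2 : ℝ≥0)) (n : ℕ) :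
    ∃ ξ : Finset ι, (2 * lam * ∫⁻ x in B, σ x) + (2 * (ξ.card : ℝ≥0∞) * (lam * Φ) +
        Fintype.card ι * ((1 / 5 * lam : ℝ≥0) * Φ)) ≤
      A.expectedPseudoRisk (E ξ) n + (lam ^ 2 : ℝ≥0) * n := by
  set K : ℝ≥0∞ := (1 / 5 * lam : ℝ≥0) * Φ with hK
  let G (q : ι) (ξ : Finset ι) : ℝ≥0∞ := ∫⁻ ω, (A.localRisk (fun x => ENNReal.ofReal ((E ξ).s x))
    (D q) ω + (lam ^ 2 : ℝ≥0) * A.allocation (D q) ω) ∂(A.historyLaw (E ξ) n)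
  have hV (b : Set (Point d)) : Measurable fun ω : History d A.K n =>
    (lam ^ 2 : ℝ≥0) * A.allocation b ω := measurable_allocation.const_mul _
  have hG (q : ι) : ∑ ξ : Finset ι, (if q ∈ ξ then 11 * K else K) ≤ ∑ ξ, G q ξ := by
    refine sum_hypercube_le q fun ξ hq => ?_
    calc 12 * K = 2 * (6 / 5 * lam : ℝ≥0) * Φ := by
          rw [hK, ← mul_assoc]
          congr 1
          have : (12 : ℝ≥0) * (1 / 5 * lam) = 2 * (6 / 5 * lam) := by ring
          exact_mod_cast this
      _ ≤ _ := two_point_bound (A := A) hlam (hD q) (hDc q) (hin ξ q hq) (hout ξ q hq) hr hrp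
          (hψ q) (hψ' q) (hΦ q) hsmall n
      _ ≤ _ := by
          -- Without the bump only the price of the samples is needed, and the local risk is
          -- discarded.
          refine add_le_add (lintegral_mono fun ω => ?_) (lintegral_mono fun ω => le_add_self)
          rw [localRisk_congr (hD q) fun x hx =>
            hsD (insert q ξ) q (Finset.mem_insert_self q ξ) x hx]
  -- The noise on `B` is the same for all `ξ`, so the oracle bound is enough there; the cells keep
  -- their actual cost `G`.
  have hrisk (ξ : Finset ι) : (2 * lam * ∫⁻ x in B, σ x) + ∑ q, G q ξ ≤
      A.expectedPseudoRisk (E ξ) n + (lam ^ 2 : ℝ≥0) * n := by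
    set s : Point d → ℝ≥0∞ := fun x => ENNReal.ofReal ((E ξ).s x) with hs
    have hmeas (b : Set (Point d)) : Measurable fun ω : History d A.K n =>
        A.localRisk s b ω + (lam ^ 2 : ℝ≥0) * A.allocation b ω :=
      (measurable_localRisk s).add (hV b)
    calc _ ≤ ∫⁻ ω, (A.localRisk s B ω + (lam ^ 2 : ℝ≥0) * A.allocation B ω)
            ∂(A.historyLaw (E ξ) n) + ∑ q, G q ξ := by
          gcongr
          calc _ = ∫⁻ ω, (2 * lam * ∫⁻ x in B, σ x) ∂(A.historyLaw (E ξ) n) := by simp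
            _ ≤ _ := by
              refine lintegral_mono fun ω => ?_
              rw [localRisk_congr hB (hsB ξ)]
              have h := two_mul_lintegral_le (a := 1) (c := lam ^ 2) (e := lam) one_pos
                (by positivity) (by simp) hB hBc hσ hσ' ω
              rwa [ENNReal.coe_one, one_mul] at h
      _ = ∫⁻ ω, ∑ i : Option ι, (A.localRisk s (i.elim B D) ω +
            (lam ^ 2 : ℝ≥0) * A.allocation (i.elim B D) ω) ∂(A.historyLaw (E ξ) n) := by
          rw [lintegral_finsetSum _ fun i _ => hmeas _, Fintype.sum_option]
          rfl
      _ ≤ ∫⁻ ω, (A.pseudoRisk (E ξ) ω + (lam ^ 2 : ℝ≥0) * n) ∂(A.historyLaw (E ξ) n) := by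
          refine lintegral_mono fun ω => ?_
          rw [pseudoRisk_eq_localRisk (hf ξ) (hC ξ)]
          refine sum_localRisk_add_le ?_ ?_ _ _ _
          · rintro (_ | q)
            exacts [hB, hD q]
          · rintro (_ | q) (_ | q') hne
            exacts [absurd rfl hne, hBD q', (hBD q).symm, hDD fun h => hne (by rw [h])]
      _ = _ := by
          rw [lintegral_add_right _ measurable_const]
          simp [expectedPseudoRisk]
  have htotal : ∑ ξ : Finset ι, ((2 * lam * ∫⁻ x in B, σ x) + (2 * (ξ.card : ℝ≥0∞) * (lam * Φ) +
      Fintype.card ι * K)) ≤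
      ∑ ξ : Finset ι, (A.expectedPseudoRisk (E ξ) n + (lam ^ 2 : ℝ≥0) * n) := by
    calc _ = ∑ ξ : Finset ι, ((2 * lam * ∫⁻ x in B, σ x) +
            ∑ q, (if q ∈ ξ then 11 * K else K)) := by
          refine Finset.sum_congr rfl fun ξ _ => ?_
          congr 1
          have h10 : 2 * (lam * Φ) = 10 * K := by
            rw [hK, ← mul_assoc, ← mul_assoc]
            congr 1
            have : (2 : ℝ≥0) * lam = 10 * (1 / 5 * lam) := by ring
            exact_mod_cast this
          calc _ = (ξ.card : ℝ≥0∞) * (2 * (lam * Φ)) + Fintype.card ι * K := by ring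
            _ = ∑ q : ι, ((if q ∈ ξ then 10 * K else 0) + K) := by
              rw [h10, Finset.sum_add_distrib, Finset.sum_ite_mem]
              simp
            _ = _ := by
              refine Finset.sum_congr rfl fun q _ => ?_
              split_ifs
              · ring
              · simp
      _ ≤ ∑ ξ : Finset ι, ((2 * lam * ∫⁻ x in B, σ x) + ∑ q, G q ξ) := by
          rw [Finset.sum_add_distrib, Finset.sum_add_distrib]
          gcongr 1
          rw [Finset.sum_comm, Finset.sum_comm (f := fun ξ q => G q ξ)]
          exact Finset.sum_le_sum fun q _ => hG q
      _ ≤ _ := Finset.sum_le_sum fun ξ _ => hrisk ξ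
  obtain ⟨ξ, -, h⟩ := ENNReal.exists_le_of_sum_le Finset.univ_nonempty htotal
  exact ⟨ξ, h⟩

end Algorithm

/-! ### Noise laws with rare large values. -/

/-- The law that puts mass `u ^ 2 / 2` on each of `u⁻¹` and `-u⁻¹`, and the rest on `0`. -/
def noiseLaw (u : ℝ) : Measure ℝ :=
  ENNReal.ofReal (1 - u ^ 2) • Measure.dirac 0 +
    (ENNReal.ofReal (u ^ 2 / 2) • Measure.dirac u⁻¹ +
      ENNReal.ofReal (u ^ 2 / 2) • Measure.dirac (-u⁻¹))

theorem isProbabilityMeasure_noiseLaw {u : ℝ} (h₀ : 0 < u) (h₁ : u ≤ 1) :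
    IsProbabilityMeasure (noiseLaw u) := by
  refine ⟨?_⟩
  have : u ^ 2 ≤ 1 := pow_le_one₀ h₀.le h₁
  simp only [noiseLaw, Measure.add_apply, Measure.smul_apply, measure_univ, smul_eq_mul, mul_one]
  rw [← ENNReal.ofReal_add (by positivity) (by positivity),
    ← ENNReal.ofReal_add (by linarith) (by positivity)]
  simp

theorem integral_noiseLaw {u : ℝ} (h₀ : 0 < u) (h₁ : u ≤ 1) (g : ℝ → ℝ) :
    ∫ ε, g ε ∂(noiseLaw u) =
      (1 - u ^ 2) * g 0 + (u ^ 2 / 2 * g u⁻¹ + u ^ 2 / 2 * g (-u⁻¹)) := by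
  have hi (a x : ℝ) : Integrable g (ENNReal.ofReal a • Measure.dirac x) :=
    (integrable_dirac (by simp)).smul_measure ENNReal.ofReal_ne_top
  have : u ^ 2 ≤ 1 := pow_le_one₀ h₀.le h₁
  rw [noiseLaw, integral_add_measure (hi _ _) ((hi _ _).add_measure (hi _ _)),
    integral_add_measure (hi _ _) (hi _ _)]
  simp only [integral_smul_measure, integral_dirac, smul_eq_mul]
  rw [ENNReal.toReal_ofReal (by linarith), ENNReal.toReal_ofReal (by positivity)]

theorem ae_noiseLaw {u : ℝ} (h₀ : 0 < u) : ∀ᵐ ε ∂(noiseLaw u), |ε| ≤ u⁻¹ := by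
  have h : (0 : ℝ) ≤ u⁻¹ := by positivity
  rw [noiseLaw, ae_add_measure_iff, ae_add_measure_iff]
  refine ⟨Measure.ae_smul_measure ?_ _, Measure.ae_smul_measure ?_ _, Measure.ae_smul_measure ?_ _⟩ <;>
    simp [ae_dirac_eq, abs_of_nonneg h₀.le, h]

theorem memLp_noiseLaw {u : ℝ} (h₀ : 0 < u) (h₁ : u ≤ 1) :
    MemLp (fun ε : ℝ => ε) 2 (noiseLaw u) := by
  have := isProbabilityMeasure_noiseLaw h₀ h₁
  exact MemLp.of_bound measurable_id.aestronglyMeasurable u⁻¹ (ae_noiseLaw h₀)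

/-- A bump supported in the ball of radius `ρ` around `c`. -/
def bump (α ρ : ℝ) (c x : Point d) : ℝ := max 0 (ρ ^ α - dist x c ^ α)

/-- A ramp that vanishes on the half `x i ≤ 1 / 2` of the cube. -/
def ramp (i : Fin d) (x : Point d) : ℝ := max 0 (x i - 1 / 2)

/-! ### Bumps: Hölder regularity and integrals. -/

section bump

variable {α ρ : ℝ} {c x y : Point d}

theorem bump_nonneg : 0 ≤ bump α ρ c x := le_max_left _ _

theorem bump_le (hρ : 0 ≤ ρ) : bump α ρ c x ≤ ρ ^ α :=
  max_le (by positivity) (sub_le_self _ (by positivity))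

theorem bump_eq_zero (hα : 0 < α) (hρ : 0 ≤ ρ) (hx : x ∉ Metric.ball c ρ) : bump α ρ c x = 0 := by
  rw [Metric.mem_ball, not_lt] at hx
  exact max_eq_left (sub_nonpos.2 (Real.rpow_le_rpow hρ hx hα.le))

/-- Triangle inequality and subadditivity of `t ↦ t ^ α` for `α ≤ 1`; the Hölder constant is `1`
whatever the radius. -/
theorem bump_sub_le (hα : 0 < α) (hα₁ : α ≤ 1) (hx : x ∈ Metric.ball c ρ) :
    bump α ρ c x - bump α ρ c y ≤ dist x y ^ α := by
  have h1 : bump α ρ c x = ρ ^ α - dist x c ^ α :=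
    max_eq_right (sub_nonneg.2 (Real.rpow_le_rpow dist_nonneg (Metric.mem_ball.1 hx).le hα.le))
  have h2 : ρ ^ α - dist y c ^ α ≤ bump α ρ c y := le_max_right _ _
  have h3 : dist y c ^ α ≤ dist x y ^ α + dist x c ^ α :=
    (Real.rpow_le_rpow dist_nonneg (dist_triangle_left y c x) hα.le).trans
      (Real.rpow_add_le_add_rpow dist_nonneg dist_nonneg hα.le hα₁)
  linarith

theorem continuous_bump (hα : 0 < α) : Continuous (bump α ρ c) := by
  unfold bump
  have : Continuous fun x : Point d => dist x c ^ α :=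
    (continuous_id.dist continuous_const).rpow_const fun x => Or.inr hα.le
  fun_prop

theorem bump_eq_bump_zero : bump α ρ c x = bump α ρ 0 (x - c) := by
  simp [bump, dist_eq_norm]

theorem integrable_bump (hα : 0 < α) (hρ : 0 ≤ ρ) : Integrable (bump α ρ c) := by
  have : IntegrableOn (bump α ρ c) (Metric.ball c ρ) := by
    have : IsFiniteMeasure (volume.restrict (Metric.ball c ρ)) :=
      ⟨by simpa using measure_ball_lt_top⟩
    refine Integrable.of_bound (continuous_bump hα).aestronglyMeasurable (ρ ^ α)
      (ae_of_all _ fun x => ?_)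
    rw [Real.norm_of_nonneg bump_nonneg]
    exact bump_le hρ
  rwa [integrableOn_iff_integrable_of_support_subset] at this
  intro x hx
  by_contra h
  exact hx (bump_eq_zero hα hρ h)

theorem setIntegral_bump (hα : 0 < α) (hρ : 0 ≤ ρ) {s : Set (Point d)}
    (hs : Metric.ball c ρ ⊆ s) : ∫ x in s, bump α ρ c x = ∫ x, bump α ρ (0 : Point d) x := by
  rw [setIntegral_eq_integral_of_forall_compl_eq_zero fun x hx =>
    bump_eq_zero hα hρ fun h => hx (hs h)]
  simp_rw [bump_eq_bump_zero (c := c)]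
  exact integral_sub_right_eq_self (bump α ρ 0) c

theorem volume_real_ball (d : ℕ) (hd : 1 ≤ d) (hρ : 0 ≤ ρ) :
    volume.real (Metric.ball (0 : Point d) ρ) =
      ρ ^ d * volume.real (Metric.ball (0 : Point d) 1) := by
  have : Nonempty (Fin d) := ⟨⟨0, hd⟩⟩
  simp [Measure.real, Measure.addHaar_ball volume (0 : Point d) hρ,
    ENNReal.toReal_ofReal (pow_nonneg hρ d)]

theorem integral_bump_le (hd : 1 ≤ d) (hα : 0 < α) (hρ : 0 ≤ ρ) :
    ∫ x, bump α ρ (0 : Point d) x ≤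
      ρ ^ α * ρ ^ d * volume.real (Metric.ball (0 : Point d) 1) := by
  rw [← setIntegral_bump (c := 0) hα hρ subset_rfl, mul_assoc, ← volume_real_ball d hd hρ]
  calc _ ≤ ∫ x in Metric.ball (0 : Point d) ρ, ρ ^ α :=
        setIntegral_mono (integrable_bump hα hρ).integrableOn
          (integrableOn_const measure_ball_lt_top.ne) fun x => bump_le hρ
    _ = _ := by rw [setIntegral_const, smul_eq_mul, mul_comm]

/-- On the concentric ball of half the radius, the bump is at least `(1 - (1 / 2) ^ α) * ρ ^ α`. -/
theorem le_integral_bump (hd : 1 ≤ d) (hα : 0 < α) (hρ : 0 ≤ ρ) :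
    (1 - (1 / 2) ^ α) * ρ ^ α * (ρ / 2) ^ d * volume.real (Metric.ball (0 : Point d) 1) ≤
      ∫ x, bump α ρ (0 : Point d) x := by
  have hint := integrable_bump (c := (0 : Point d)) hα hρ
  rw [mul_assoc, ← volume_real_ball d hd (by positivity)]
  calc _ = ∫ x in Metric.ball (0 : Point d) (ρ / 2), (1 - (1 / 2) ^ α) * ρ ^ α := by
        rw [setIntegral_const, smul_eq_mul, mul_comm]
    _ ≤ ∫ x in Metric.ball (0 : Point d) (ρ / 2), bump α ρ (0 : Point d) x := by
        refine setIntegral_mono_on (integrableOn_const measure_ball_lt_top.ne) hint.integrableOn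
          Metric.isOpen_ball.measurableSet fun x hx => le_trans ?_ (le_max_right _ _)
        have : dist x 0 ^ α ≤ (1 / 2) ^ α * ρ ^ α := by
          rw [← Real.mul_rpow (by norm_num) hρ]
          refine Real.rpow_le_rpow dist_nonneg ?_ hα.le
          have := Metric.mem_ball.1 hx
          linarith
        linarith
    _ ≤ _ := setIntegral_le_integral hint (ae_of_all _ fun x => bump_nonneg)

end bump

/-! ### The ramp. -/

section ramp

variable {i : Fin d} {x y : Point d}

theorem ramp_nonneg : 0 ≤ ramp i x := le_max_left _ _

theorem ramp_eq_zero (hx : x i ≤ 1 / 2) : ramp i x = 0 := max_eq_left (sub_nonpos.2 hx)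

theorem ramp_le (hx : x ∈ unitCube d) : ramp i x ≤ 1 / 2 :=
  max_le (by norm_num) (by have := (hx i).2; linarith)

theorem continuous_ramp : Continuous (ramp i) := by unfold ramp; fun_prop

/-- The ramp is `1`-Lipschitz, and coordinate differences in the cube are at most `1`, where `t ≤ t
^ α`. -/
theorem ramp_sub_le {α : ℝ} (hα : 0 < α) (hα₁ : α ≤ 1) (hx : x ∈ unitCube d)
    (hy : y ∈ unitCube d) : ramp i x - ramp i y ≤ dist x y ^ α := by
  rcases le_total (x i) (y i) with h | h
  · have : ramp i x ≤ ramp i y := max_le_max le_rfl (by linarith)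
    have : 0 ≤ dist x y ^ α := by positivity
    linarith
  · have h1 : ramp i x ≤ (x i - y i) + ramp i y := by
      refine max_le (by have := ramp_nonneg (i := i) (x := y); linarith) ?_
      have : y i - 1 / 2 ≤ ramp i y := le_max_right _ _
      linarith
    have h2 : x i - y i ≤ (x i - y i) ^ α :=
      Real.self_le_rpow_of_le_one (by linarith) (by have := (hx i).2; have := (hy i).1; linarith)
        hα₁
    have h3 : x i - y i ≤ dist x y := by
      rw [dist_eq_norm]
      exact (le_abs_self _).trans (by simpa using PiLp.norm_apply_le (x - y) i)
    have := Real.rpow_le_rpow (by linarith) h3 hα.le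
    linarith

theorem isFiniteMeasure_restrict_unitCube :
    IsFiniteMeasure (volume.restrict (unitCube d)) := ⟨by simp [volume_unitCube]⟩

theorem integrableOn_ramp : IntegrableOn (ramp i) (unitCube d) := by
  have := isFiniteMeasure_restrict_unitCube (d := d)
  refine Integrable.of_bound continuous_ramp.aestronglyMeasurable (1 / 2) ?_
  filter_upwards [ae_restrict_mem (measurableSet_unitCube d)] with x hx
  rw [Real.norm_of_nonneg ramp_nonneg]
  exact ramp_le hx

theorem integral_ramp_pos : 0 < ∫ x in unitCube d, ramp i x := by
  rw [setIntegral_pos_iff_support_of_nonneg_ae (ae_of_all _ fun x => ramp_nonneg) integrableOn_ramp]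
  -- The ball inscribed in the subcube `[1/2, 1] ^ d`.
  have hsub : Metric.ball (WithLp.toLp 2 fun _ : Fin d => (3 / 4 : ℝ)) (1 / 4) ⊆
      Function.support (ramp i) ∩ unitCube d := by
    intro x hx
    have hx' (j : Fin d) : |x j - 3 / 4| < 1 / 4 := by
      refine lt_of_le_of_lt ?_ (Metric.mem_ball.1 hx)
      rw [dist_eq_norm]
      simpa using PiLp.norm_apply_le (x - WithLp.toLp 2 fun _ : Fin d => (3 / 4 : ℝ)) j
    refine ⟨?_, fun j => ?_⟩
    · have := (abs_lt.1 (hx' i)).1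
      exact (lt_max_of_lt_right (by linarith)).ne'
    · have := abs_lt.1 (hx' j)
      exact ⟨by linarith, by linarith⟩
  exact (Metric.measure_ball_pos volume _ (by norm_num)).trans_le (measure_mono hsub)

end ramp

/-! ### The environments of the hypercube. -/

theorem measurableSet_half (i : Fin d) : MeasurableSet {x : Point d | x i ≤ 1 / 2} :=
  measurableSet_le (by fun_prop) measurable_const

open scoped Classical in
/-- The noise laws: rare large values on the half `x i ≤ 1 / 2`, random signs elsewhere. -/
def noiseKernel (i : Fin d) (u : ℝ) : Kernel (Point d) ℝ :=
  Kernel.piecewise (measurableSet_half i) (Kernel.const _ (noiseLaw u))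
    (Kernel.const _ (noiseLaw 1))

theorem noiseKernel_of_le {i : Fin d} {u : ℝ} {x : Point d} (hx : x i ≤ 1 / 2) :
    noiseKernel i u x = noiseLaw u := by
  simp only [noiseKernel, Kernel.piecewise_apply, Kernel.const_apply]
  exact if_pos hx

theorem noiseKernel_of_lt {i : Fin d} {u : ℝ} {x : Point d} (hx : 1 / 2 < x i) :
    noiseKernel i u x = noiseLaw 1 := by
  simp only [noiseKernel, Kernel.piecewise_apply, Kernel.const_apply]
  exact if_neg hx.not_ge

theorem exists_noiseKernel_eq {i : Fin d} {u : ℝ} (h₀ : 0 < u) (h₁ : u ≤ 1) (x : Point d) :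
    ∃ v : ℝ, 0 < v ∧ v ≤ 1 ∧ noiseKernel i u x = noiseLaw v := by
  rcases le_or_gt (x i) (1 / 2) with h | h
  · exact ⟨u, h₀, h₁, noiseKernel_of_le h⟩
  · exact ⟨1, one_pos, le_rfl, noiseKernel_of_lt h⟩

/-- The noise level: a ramp, plus the bumps of the cells in `ξ`. -/
def noiseLevel {ι : Type*} (i : Fin d) (L α ρ : ℝ) (c : ι → Point d) (ξ : Finset ι)
    (x : Point d) : ℝ :=
  L * (ramp i x + ∑ q ∈ ξ, bump α ρ (c q) x)

theorem continuous_noiseLevel {ι : Type*} {i : Fin d} {L α ρ : ℝ} (hα : 0 < α)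
    {c : ι → Point d} {ξ : Finset ι} : Continuous (noiseLevel i L α ρ c ξ) :=
  continuous_const.mul (continuous_ramp.add (continuous_finsetSum _ fun _ _ => continuous_bump hα))

theorem noiseLevel_nonneg {ι : Type*} {i : Fin d} {L α ρ : ℝ} (hL : 0 ≤ L)
    {c : ι → Point d} {ξ : Finset ι} (x : Point d) : 0 ≤ noiseLevel i L α ρ c ξ x :=
  mul_nonneg hL (add_nonneg ramp_nonneg (Finset.sum_nonneg fun _ _ => bump_nonneg))

/-- The environments of the hypercube. -/
def bumpEnvironment {ι : Type*} (i : Fin d) {L α u : ℝ} (hL : 0 ≤ L) (hα : 0 < α) (h₀ : 0 < u)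
    (h₁ : u ≤ 1) (ρ : ℝ) (c : ι → Point d) (ξ : Finset ι) : Environment d where
  f _ := 1 / 2
  s := noiseLevel i L α ρ c ξ
  ν := noiseKernel i u
  measurable_f := measurable_const
  measurable_s := (continuous_noiseLevel hα).measurable
  s_nonneg x _ := noiseLevel_nonneg hL x
  isMarkov := ⟨fun x => by
    obtain ⟨v, hv₀, hv₁, hv⟩ := exists_noiseKernel_eq (i := i) h₀ h₁ x
    exact hv ▸ isProbabilityMeasure_noiseLaw hv₀ hv₁⟩
  memLp_noise x := by
    obtain ⟨v, hv₀, hv₁, hv⟩ := exists_noiseKernel_eq (i := i) h₀ h₁ x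
    exact hv ▸ memLp_noiseLaw hv₀ hv₁
  noise_mean x := by
    obtain ⟨v, hv₀, hv₁, hv⟩ := exists_noiseKernel_eq (i := i) h₀ h₁ x
    rw [hv, integral_noiseLaw hv₀ hv₁]
    ring
  noise_variance x := by
    obtain ⟨v, hv₀, hv₁, hv⟩ := exists_noiseKernel_eq (i := i) h₀ h₁ x
    rw [hv, integral_noiseLaw hv₀ hv₁]
    field_simp
    ring

section cells

variable {ι : Type*} {i : Fin d} {L α ρ u : ℝ} {c : ι → Point d} {ξ : Finset ι} {q : ι}
  {x y : Point d}

/-- Disjoint cells inside the half `x i ≤ 1 / 2` of the cube. -/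
structure IsCellFamily (i : Fin d) (ρ : ℝ) (c : ι → Point d) : Prop where
  radius_nonneg : 0 ≤ ρ
  disjoint : Pairwise fun q q' => Disjoint (Metric.ball (c q) ρ) (Metric.ball (c q') ρ)
  subset_unitCube : ∀ q, Metric.ball (c q) ρ ⊆ unitCube d
  subset_half : ∀ q, ∀ x ∈ Metric.ball (c q) ρ, x i ≤ 1 / 2

namespace IsCellFamily

variable (hc : IsCellFamily i ρ c)
include hc

theorem sum_bump_eq (hα : 0 < α) (hq : q ∈ ξ) (hx : x ∈ Metric.ball (c q) ρ) :
    ∑ q' ∈ ξ, bump α ρ (c q') x = bump α ρ (c q) x :=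
  Finset.sum_eq_single_of_mem q hq fun _ _ hne =>
    bump_eq_zero hα hc.radius_nonneg fun h => (hc.disjoint hne).le_bot ⟨h, hx⟩

theorem sum_bump_eq_zero (hα : 0 < α) (hx : ∀ q ∈ ξ, x ∉ Metric.ball (c q) ρ) :
    ∑ q ∈ ξ, bump α ρ (c q) x = 0 :=
  Finset.sum_eq_zero fun q hq => bump_eq_zero hα hc.radius_nonneg (hx q hq)

theorem sum_bump_le (hα : 0 < α) : ∑ q ∈ ξ, bump α ρ (c q) x ≤ ρ ^ α := by
  have hρ := hc.radius_nonneg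
  by_cases h : ∃ q ∈ ξ, x ∈ Metric.ball (c q) ρ
  · obtain ⟨q, hq, hx⟩ := h
    rw [hc.sum_bump_eq hα hq hx]
    exact bump_le hρ
  · push Not at h
    rw [hc.sum_bump_eq_zero hα h]
    positivity

/-- At most one bump is nonzero at `x`, and the sum at `y` dominates that bump at `y`. Hence the
Hölder constant does not grow with the number of cells. -/
theorem sum_bump_sub_le (hα : 0 < α) (hα₁ : α ≤ 1) :
    ∑ q ∈ ξ, bump α ρ (c q) x - ∑ q ∈ ξ, bump α ρ (c q) y ≤ dist x y ^ α := by
  by_cases h : ∃ q ∈ ξ, x ∈ Metric.ball (c q) ρ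
  · obtain ⟨q, hq, hx⟩ := h
    rw [hc.sum_bump_eq hα hq hx]
    have h1 : bump α ρ (c q) y ≤ ∑ q ∈ ξ, bump α ρ (c q) y :=
      Finset.single_le_sum (f := fun q => bump α ρ (c q) y) (fun _ _ => bump_nonneg) hq
    have h2 := bump_sub_le (y := y) hα hα₁ hx
    linarith
  · push Not at h
    rw [hc.sum_bump_eq_zero hα h, zero_sub]
    have h1 : 0 ≤ ∑ q ∈ ξ, bump α ρ (c q) y := Finset.sum_nonneg fun _ _ => bump_nonneg
    have : 0 ≤ dist x y ^ α := by positivity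
    linarith

theorem noiseLevel_of_mem (hα : 0 < α) (hq : q ∈ ξ) (hx : x ∈ Metric.ball (c q) ρ) :
    noiseLevel i L α ρ c ξ x = L * bump α ρ (c q) x := by
  rw [noiseLevel, ramp_eq_zero (hc.subset_half q x hx), hc.sum_bump_eq hα hq hx, zero_add]

theorem noiseLevel_of_notMem (hα : 0 < α) (hq : q ∉ ξ) (hx : x ∈ Metric.ball (c q) ρ) :
    noiseLevel i L α ρ c ξ x = 0 := by
  rw [noiseLevel, ramp_eq_zero (hc.subset_half q x hx), hc.sum_bump_eq_zero hα, add_zero, mul_zero]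
  exact fun q' hq' h => (hc.disjoint (ne_of_mem_of_not_mem hq' hq)).le_bot ⟨h, hx⟩

theorem noiseLevel_of_lt (hα : 0 < α) (hx : 1 / 2 < x i) :
    noiseLevel i L α ρ c ξ x = L * ramp i x := by
  rw [noiseLevel, hc.sum_bump_eq_zero hα, add_zero]
  exact fun q _ h => hx.not_ge (hc.subset_half q x h)

theorem noiseLevel_of_le (hL : 0 ≤ L) (hα : 0 < α) (hx : x i ≤ 1 / 2) :
    noiseLevel i L α ρ c ξ x ≤ L * ρ ^ α := by
  rw [noiseLevel, ramp_eq_zero hx, zero_add]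
  exact mul_le_mul_of_nonneg_left (hc.sum_bump_le hα) hL

theorem noiseLevel_le (hL : 0 ≤ L) (hα : 0 < α) (hx : x ∈ unitCube d) :
    noiseLevel i L α ρ c ξ x ≤ L * (1 / 2 + ρ ^ α) :=
  mul_le_mul_of_nonneg_left (add_le_add (ramp_le hx) (hc.sum_bump_le hα)) hL

theorem integral_noiseLevel (hα : 0 < α) :
    ∫ x in unitCube d, noiseLevel i L α ρ c ξ x =
      L * (∫ x in unitCube d, ramp i x) + ξ.card * (L * ∫ x, bump α ρ (0 : Point d) x) := by
  have hρ := hc.radius_nonneg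
  unfold noiseLevel
  rw [integral_const_mul, integral_add integrableOn_ramp
    (integrable_finsetSum _ fun q _ => (integrable_bump hα hρ).integrableOn),
    integral_finsetSum _ fun q _ => (integrable_bump hα hρ).integrableOn]
  simp_rw [fun q => setIntegral_bump hα hρ (hc.subset_unitCube q)]
  simp
  ring

theorem mem_holderEnvironments {α M : ℝ≥0} (hα : 0 < α) (hα₁ : α ≤ 1) (hL : 0 ≤ L)
    (hLM : 2 * L ≤ M) (h₀ : 0 < u) (h₁ : u ≤ 1) :
    bumpEnvironment i hL (α := α) hα h₀ h₁ ρ c ξ ∈ holderEnvironments d α M := by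
  refine ⟨fun x _ y _ => by simp [bumpEnvironment], fun x hx y hy => ?_⟩
  have key (x y : Point d) (hx : x ∈ unitCube d) (hy : y ∈ unitCube d) :
      noiseLevel i L α ρ c ξ x - noiseLevel i L α ρ c ξ y ≤ M * dist x y ^ (α : ℝ) := by
    have h1 := ramp_sub_le (i := i) (α := α) hα hα₁ hx hy
    have h2 := hc.sum_bump_sub_le (x := x) (y := y) (ξ := ξ) (α := α) hα hα₁
    have h3 : 0 ≤ dist x y ^ (α : ℝ) := by positivity
    calc _ = L * ((ramp i x - ramp i y) +
          (∑ q ∈ ξ, bump α ρ (c q) x - ∑ q ∈ ξ, bump α ρ (c q) y)) := by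
          unfold noiseLevel; ring
      _ ≤ L * (dist x y ^ (α : ℝ) + dist x y ^ (α : ℝ)) := by gcongr
      _ = 2 * L * dist x y ^ (α : ℝ) := by ring
      _ ≤ _ := by gcongr
  change edist (noiseLevel i L α ρ c ξ x) (noiseLevel i L α ρ c ξ y) ≤ _
  rw [edist_dist, edist_dist, ENNReal.ofReal_rpow_of_nonneg dist_nonneg α.coe_nonneg,
    ← ENNReal.ofReal_coe_nnreal, ← ENNReal.ofReal_mul M.coe_nonneg]
  refine ENNReal.ofReal_le_ofReal (abs_sub_le_iff.2 ⟨key x y hx hy, ?_⟩)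
  rw [dist_comm]
  exact key y x hy hx

/-- Noise of size `u⁻¹` is multiplied by a level at most `u / 2`, so observations stay within `1/2`
of `f = 1/2`; on the ramp the same holds with `1` in place of `u`. -/
theorem mem_boundedEnvironments (hα : 0 < α) (hL : 0 ≤ L) (hL₁ : L ≤ 1) (h₀ : 0 < u) (h₁ : u ≤ 1)
    (hu : L * ρ ^ α ≤ u / 2) :
    bumpEnvironment i hL hα h₀ h₁ ρ c ξ ∈ boundedEnvironments d := by
  intro x hx
  change ∀ᵐ ε ∂(noiseKernel i u x), 1 / 2 + noiseLevel i L α ρ c ξ x * ε ∈ Set.Icc (0 : ℝ) 1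
  have hs := noiseLevel_nonneg (i := i) (α := α) (ρ := ρ) (c := c) (ξ := ξ) hL x
  have key (v : ℝ) (hv : 0 < v) (hle : noiseLevel i L α ρ c ξ x ≤ v / 2) :
      ∀ᵐ ε ∂(noiseLaw v), 1 / 2 + noiseLevel i L α ρ c ξ x * ε ∈ Set.Icc (0 : ℝ) 1 := by
    filter_upwards [ae_noiseLaw hv] with ε hε
    have h2 : |noiseLevel i L α ρ c ξ x * ε| ≤ 1 / 2 := by
      rw [abs_mul, abs_of_nonneg hs]
      calc _ ≤ v / 2 * v⁻¹ := by gcongr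
        _ = 1 / 2 := by field_simp
    have h3 := abs_le.1 h2
    exact ⟨by linarith, by linarith⟩
  rcases le_or_gt (x i) (1 / 2) with h | h
  · rw [noiseKernel_of_le h]
    exact key u h₀ ((hc.noiseLevel_of_le hL hα h).trans hu)
  · rw [noiseKernel_of_lt h]
    refine key 1 one_pos ?_
    rw [hc.noiseLevel_of_lt hα h]
    calc L * ramp i x ≤ 1 * (1 / 2) := by
          gcongr
          · exact ramp_nonneg
          · exact ramp_le hx
      _ = _ := by norm_num

/-- Without the bump the observation is the constant `1/2`; with it, the atom of the noise at `0`
still produces `1/2` with mass `1 - u ^ 2`. -/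
theorem smul_obs_le [DecidableEq ι] (hα : 0 < α) (hL : 0 ≤ L) (h₀ : 0 < u) (h₁ : u ≤ 1)
    (hq : q ∉ ξ) (hx : x ∈ Metric.ball (c q) ρ) :
    ENNReal.ofReal (1 - u ^ 2) • (bumpEnvironment i hL hα h₀ h₁ ρ c ξ).obs x ≤
      (bumpEnvironment i hL hα h₀ h₁ ρ c (insert q ξ)).obs x := by
  have hm (a : ℝ) : Measurable fun ε : ℝ => 1 / 2 + a * ε := by fun_prop
  have := isProbabilityMeasure_noiseLaw h₀ h₁
  rw [Environment.obs_apply, Environment.obs_apply]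
  change ENNReal.ofReal (1 - u ^ 2) •
      (noiseKernel i u x).map (fun ε => 1 / 2 + noiseLevel i L α ρ c ξ x * ε) ≤
    (noiseKernel i u x).map fun ε => 1 / 2 + noiseLevel i L α ρ c (insert q ξ) x * ε
  rw [noiseKernel_of_le (hc.subset_half q x hx), hc.noiseLevel_of_notMem hα hq hx]
  simp only [zero_mul, add_zero, Measure.map_const, measure_univ, one_smul]
  rw [noiseLaw, Measure.map_add _ _ (hm _), Measure.map_smul, Measure.map_dirac' (hm _)]
  simp only [mul_zero, add_zero]
  exact Measure.le_add_right le_rfl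

theorem obs_eq [DecidableEq ι] (hα : 0 < α) (hL : 0 ≤ L) (h₀ : 0 < u) (h₁ : u ≤ 1)
    (hq : q ∉ ξ) (hx : x ∉ Metric.ball (c q) ρ) :
    (bumpEnvironment i hL hα h₀ h₁ ρ c ξ).obs x =
      (bumpEnvironment i hL hα h₀ h₁ ρ c (insert q ξ)).obs x := by
  have : noiseLevel i L α ρ c (insert q ξ) x = noiseLevel i L α ρ c ξ x := by
    rw [noiseLevel, noiseLevel, Finset.sum_insert hq, bump_eq_zero hα hc.radius_nonneg hx, zero_add]
  rw [Environment.obs_apply, Environment.obs_apply]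
  change (noiseKernel i u x).map (fun ε => 1 / 2 + noiseLevel i L α ρ c ξ x * ε) =
    (noiseKernel i u x).map fun ε => 1 / 2 + noiseLevel i L α ρ c (insert q ξ) x * ε
  rw [this]

end IsCellFamily

/-- The centers of the cells of a regular grid of the cube `[0, 1 / 2] ^ d`. -/
def gridCenter (J : ℕ) (q : Fin d → Fin J) : Point d :=
  WithLp.toLp 2 fun j => (2 * (q j : ℝ) + 1) / (4 * J)

/-- After scaling by `4 * J`, each coordinate in a cell is within `1` of the odd integer `2 * q j +
1`, which determines `q j`. -/
theorem isCellFamily_gridCenter (i : Fin d) {J : ℕ} (hJ : 0 < J) :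
    IsCellFamily i (1 / (4 * J)) (gridCenter (d := d) J) := by
  have hJ' : (0 : ℝ) < J := by exact_mod_cast hJ
  have hcoord {q : Fin d → Fin J} {x : Point d}
      (hx : x ∈ Metric.ball (gridCenter J q) (1 / (4 * J))) (j : Fin d) :
      |4 * J * x j - (2 * (q j : ℝ) + 1)| < 1 := by
    have h1 : |x j - (2 * (q j : ℝ) + 1) / (4 * J)| < 1 / (4 * J) := by
      refine lt_of_le_of_lt ?_ (Metric.mem_ball.1 hx)
      rw [dist_eq_norm]
      simpa [gridCenter] using PiLp.norm_apply_le (x - gridCenter J q) j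
    have h2 : 4 * J * x j - (2 * (q j : ℝ) + 1) =
        4 * J * (x j - (2 * (q j : ℝ) + 1) / (4 * J)) := by field_simp
    rw [h2, abs_mul, abs_of_pos (by positivity)]
    calc _ < 4 * (J : ℝ) * (1 / (4 * J)) := by gcongr
      _ = 1 := by field_simp
  have hmem {q : Fin d → Fin J} {x : Point d}
      (hx : x ∈ Metric.ball (gridCenter J q) (1 / (4 * J))) (j : Fin d) :
      0 ≤ x j ∧ x j ≤ 1 / 2 := by
    have h1 := abs_lt.1 (hcoord hx j)
    have h2 : (q j : ℝ) + 1 ≤ J := by exact_mod_cast (q j).2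
    have h3 : (0 : ℝ) ≤ (q j : ℝ) := by positivity
    constructor
    · have : 0 < 4 * J * x j := by linarith
      exact (pos_of_mul_pos_right this (by positivity)).le
    · have : 4 * J * x j ≤ 4 * J * (1 / 2) := by linarith
      exact le_of_mul_le_mul_left this (by positivity)
  refine ⟨by positivity, fun q q' hne => ?_, fun q x hx j => ?_, fun q x hx => (hmem hx i).2⟩
  · refine Set.disjoint_left.2 fun x hx hx' => ?_
    refine hne (funext fun j => ?_)
    have h1 := abs_lt.1 (hcoord hx j)
    have h2 := abs_lt.1 (hcoord hx' j)
    have h3 : (q j : ℝ) < q' j + 1 := by linarith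
    have h4 : (q' j : ℝ) < q j + 1 := by linarith
    have h5 : (q j : ℕ) < q' j + 1 := by exact_mod_cast h3
    have h6 : (q' j : ℕ) < q j + 1 := by exact_mod_cast h4
    exact Fin.ext (by omega)
  · exact ⟨(hmem hx j).1, (hmem hx j).2.trans (by norm_num)⟩

end cells

/-! ### From the hypercube bound to the rate. -/

/-- One of the environments of the hypercube has a large excess. -/
theorem IsCellFamily.exists_le_excess {ι : Type*} [Fintype ι] [DecidableEq ι] {i : Fin d}
    {L α ρ u : ℝ} {c : ι → Point d} (hc : IsCellFamily i ρ c) (hα : 0 < α) (hL : 0 < L)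
    (h₀ : 0 < u) (h₁ : u ≤ 1) (A : Algorithm d) {n : ℕ} (hn : 1 ≤ n) {Λ F : ℝ}
    (hΛ : L * (∫ x in unitCube d, ramp i x) = Λ) (hF : L * (∫ x, bump α ρ (0 : Point d) x) = F)
    (hdetect : 8 / 5 * F * u ^ 2 ≤ Λ / n) (hsize : Fintype.card ι * F ≤ Λ / 10) :
    ∃ ξ : Finset ι, ((Fintype.card ι * F * Λ / (10 * n) : ℝ) : EReal) ≤
      A.excess (bumpEnvironment i hL.le hα h₀ h₁ ρ c ξ) n := by
  have hn' : (0 : ℝ) < n := by exact_mod_cast hn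
  have hρ := hc.radius_nonneg
  have hu : u ^ 2 ≤ 1 := pow_le_one₀ h₀.le h₁
  have hΛ₀ : 0 < Λ := hΛ ▸ mul_pos hL integral_ramp_pos
  have hF₀ : 0 ≤ F := hF ▸ mul_nonneg hL.le (integral_nonneg fun _ => bump_nonneg)
  -- The Lagrange multiplier for which the oracle density `s / lam` of the ramp alone uses up the
  -- budget `n`.
  set lam : ℝ := Λ / n with hlam
  have hlam₀ : 0 < lam := by positivity
  have hlamn : lam * n = Λ := by rw [hlam]; field_simp
  set B : Set (Point d) := unitCube d ∩ {x | 1 / 2 < x i} with hBdef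
  have hB : MeasurableSet B :=
    (measurableSet_unitCube d).inter (measurableSet_lt measurable_const (by fun_prop))
  have hσint : ∫⁻ x in B, ENNReal.ofReal (L * ramp i x) = ENNReal.ofReal Λ := by
    rw [← ofReal_integral_eq_lintegral_ofReal
      ((integrableOn_ramp.mono_set Set.inter_subset_left).const_mul L)
      (ae_of_all _ fun x => mul_nonneg hL.le ramp_nonneg), integral_const_mul, ← hΛ,
      ← setIntegral_eq_of_subset_of_forall_sdiff_eq_zero (measurableSet_unitCube d)
        Set.inter_subset_left fun x hx => ?_]
    exact ramp_eq_zero (not_lt.1 fun h => hx.2 ⟨hx.1, h⟩)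
  have hψint (q : ι) : ∫⁻ x in Metric.ball (c q) ρ, ENNReal.ofReal (L * bump α ρ (c q) x) =
      ENNReal.ofReal F := by
    rw [← ofReal_integral_eq_lintegral_ofReal ((integrable_bump hα hρ).integrableOn.const_mul L)
      (ae_of_all _ fun x => mul_nonneg hL.le bump_nonneg), integral_const_mul,
      setIntegral_bump hα hρ subset_rfl, hF]
  obtain ⟨ξ, hξ⟩ := A.exists_le_expectedPseudoRisk
    (fun ξ => bumpEnvironment i hL.le hα h₀ h₁ ρ c ξ) (fun _ _ => rfl)
    (fun ξ x hx => hc.noiseLevel_le hL.le hα hx) hB Set.inter_subset_left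
    (D := fun q => Metric.ball (c q) ρ) (fun q => Metric.isOpen_ball.measurableSet)
    hc.subset_unitCube
    (fun q => Set.disjoint_left.2 fun x hx hx' => not_le.2 hx.2 (hc.subset_half q x hx'))
    hc.disjoint (σ := fun x => ENNReal.ofReal (L * ramp i x))
    (ψ := fun q x => ENNReal.ofReal (L * bump α ρ (c q) x))
    (continuous_const.mul continuous_ramp).measurable.ennreal_ofReal (fun _ => by simp)
    (fun q => (continuous_const.mul (continuous_bump hα)).measurable.ennreal_ofReal)
    (fun _ _ => by simp)
    (fun ξ x hx => congrArg ENNReal.ofReal (hc.noiseLevel_of_lt hα hx.2))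
    (fun ξ q hq x hx => congrArg ENNReal.ofReal (hc.noiseLevel_of_mem hα hq hx))
    (r := ENNReal.ofReal (1 - u ^ 2)) (p := ENNReal.ofReal (u ^ 2)) (Φ := ENNReal.ofReal F)
    (ENNReal.ofReal_le_one.2 (by linarith [sq_nonneg u]))
    (by rw [← ENNReal.ofReal_add (by linarith) (by positivity)]; simp)
    hψint
    (fun ξ q hq x hx => hc.smul_obs_le hα hL.le h₀ h₁ hq hx)
    (fun ξ q hq x hx => hc.obs_eq hα hL.le h₀ h₁ hq hx)
    (lam := lam.toNNReal) (Real.toNNReal_pos.2 hlam₀)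
    (by
      rw [← ENNReal.ofReal_coe_nnreal, ← ENNReal.ofReal_coe_nnreal,
        ← ENNReal.ofReal_ofNat 2, ← ENNReal.ofReal_mul (by positivity),
        ← ENNReal.ofReal_mul (by positivity), ← ENNReal.ofReal_mul (by positivity)]
      refine ENNReal.ofReal_le_ofReal ?_
      push_cast
      rw [Real.coe_toNNReal _ hlam₀.le]
      have := mul_le_mul_of_nonneg_left hdetect hlam₀.le
      linarith) n
  refine ⟨ξ, ?_⟩
  set R := A.expectedPseudoRisk (bumpEnvironment i hL.le hα h₀ h₁ ρ c ξ) n with hR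
  have hs : ∫ x in unitCube d, (bumpEnvironment i hL.le hα h₀ h₁ ρ c ξ).s x =
      Λ + ξ.card * F := by
    rw [← hΛ, ← hF]
    exact hc.integral_noiseLevel hα
  rw [Algorithm.excess, ← hR, hs]
  rcases eq_or_ne R ∞ with htop | hfin
  · rw [htop, EReal.coe_ennreal_top, EReal.top_sub_coe]
    exact le_top
  have hreal := ENNReal.toReal_mono (ENNReal.add_ne_top.2 ⟨hfin, by finiteness⟩) hξ
  rw [hσint, ENNReal.toReal_add hfin (by finiteness),
    ENNReal.toReal_add (by finiteness) (by finiteness),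
    ENNReal.toReal_add (by finiteness) (by finiteness)] at hreal
  simp only [ENNReal.toReal_mul, ENNReal.coe_toReal, ENNReal.toReal_ofReal hΛ₀.le,
    ENNReal.toReal_ofReal hF₀, ENNReal.toReal_natCast, ENNReal.toReal_ofNat, NNReal.coe_mul,
    NNReal.coe_pow, NNReal.coe_div, NNReal.coe_one, NNReal.coe_ofNat,
    Real.coe_toNNReal _ hlam₀.le] at hreal
  rw [← EReal.coe_toReal (x := (R : EReal)) (by simpa using hfin) (by simp),
    EReal.toReal_coe_ennreal, ← EReal.coe_sub, EReal.coe_le_coe_iff]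
  set N : ℝ := (Fintype.card ι : ℝ) with hN
  have hcard : (ξ.card : ℝ) ≤ N := by
    rw [hN]
    exact_mod_cast Finset.card_le_univ ξ
  have hcF : (ξ.card : ℝ) * F ≤ N * F := by gcongr
  have hcF₀ : 0 ≤ (ξ.card : ℝ) * F := by positivity
  -- As `lam` ignores the bumps, the expansion of `(∫ s) ^ 2 / n` leaves the term `(ξ.card * F) ^ 2
  -- / n` uncompensated. By `hsize` it takes at most half of the gain `N * lam * F / 5`.
  have hsq : ((ξ.card : ℝ) * F) ^ 2 ≤ N * F * (Λ / 10) := by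
    rw [sq]
    exact mul_le_mul hcF (hcF.trans hsize) hcF₀ (hcF₀.trans hcF)
  have hexp : 1 / (n : ℝ) * (Λ + ξ.card * F) ^ 2 = lam ^ 2 * n + 2 * lam * (ξ.card * F) +
      (ξ.card * F) ^ 2 / n := by
    rw [hlam]; field_simp; ring
  have hdiv : ((ξ.card : ℝ) * F) ^ 2 / n ≤ N * F * Λ / (10 * n) := by
    rw [div_le_div_iff₀ hn' (by positivity)]
    have := mul_le_mul_of_nonneg_left hsq (by positivity : 0 ≤ 10 * (n : ℝ))
    linarith
  have hgain : N * (1 / 5 * lam * F) = 2 * (N * F * Λ / (10 * n)) := by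
    rw [hlam]; field_simp; ring
  have hmain : 2 * lam * Λ = 2 * (lam ^ 2 * n) := by rw [← hlamn]; ring
  rw [hexp]
  linarith

/-- The choice of the number of cells. -/
theorem exists_grid_size {γ α : ℝ} (hα : 0 < α) (hγ : 1 ≤ γ) (κ : ℝ) :
    ∃ c₀ : ℝ, 0 < c₀ ∧ ∀ n : ℕ, 1 ≤ n → ∃ J : ℕ, 0 < J ∧
      κ * (n * (1 / (4 * (J : ℝ))) ^ γ) ≤ 1 ∧ κ * (1 / (4 * (J : ℝ))) ^ α ≤ 1 ∧
      c₀ * (n : ℝ) ^ (-(α / γ)) ≤ (1 / (4 * (J : ℝ))) ^ α := by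
  have hγ₀ : 0 < γ := one_pos.trans_le hγ
  set k : ℝ := max κ 1
  have hk : 1 ≤ k := le_max_right _ _
  have hk₀ : 0 < k := one_pos.trans_le hk
  -- Chosen so that `k ≤ b ^ γ` (as `γ ≥ 1`) and `k ≤ b ^ α`; then `J ≈ b * n ^ (1 / γ)` meets both
  -- upper bounds.
  set b : ℝ := max k (k ^ (1 / α))
  have hb : 1 ≤ b := hk.trans (le_max_left _ _)
  have hb₀ : 0 < b := one_pos.trans_le hb
  -- The factor `8` is the `4` of the radius times the `2` lost in rounding up `b * s ≥ 1`.
  refine ⟨(8 * b)⁻¹ ^ α, by positivity, fun n hn => ?_⟩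
  have hn₁ : (1 : ℝ) ≤ n := by exact_mod_cast hn
  have hn₀ : (0 : ℝ) < n := one_pos.trans_le hn₁
  set s : ℝ := (n : ℝ) ^ (1 / γ) with hs
  have hs₁ : 1 ≤ s := Real.one_le_rpow hn₁ (by positivity)
  have hs₀ : 0 < s := one_pos.trans_le hs₁
  have hbs : 1 ≤ b * s := one_le_mul_of_one_le_of_one_le hb hs₁
  have hJ₀ : 0 < ⌈b * s⌉₊ := Nat.ceil_pos.2 (by positivity)
  refine ⟨⌈b * s⌉₊, hJ₀, ?_⟩
  have hJ₁ : b * s ≤ (⌈b * s⌉₊ : ℝ) := Nat.le_ceil _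
  have hJ₂ : (⌈b * s⌉₊ : ℝ) ≤ 2 * (b * s) := by
    have := Nat.ceil_lt_add_one (by positivity : 0 ≤ b * s)
    linarith
  set J : ℝ := (⌈b * s⌉₊ : ℝ)
  have hJ : 0 < J := lt_of_lt_of_le (by positivity) hJ₁
  have hρ₁ : 1 / (4 * J) ≤ b⁻¹ * s⁻¹ := by
    rw [← mul_inv, one_div]
    exact inv_anti₀ (by positivity) (by linarith)
  have hρ₂ : (8 * b)⁻¹ * s⁻¹ ≤ 1 / (4 * J) := by
    rw [← mul_inv, one_div]
    exact inv_anti₀ (by positivity) (by linarith)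
  have hsγ : s ^ γ = n := by rw [hs, ← Real.rpow_mul hn₀.le, one_div_mul_cancel hγ₀.ne', Real.rpow_one]
  have hκ : κ ≤ k := le_max_left _ _
  refine ⟨?_, ?_, ?_⟩
  · have hbγ : k ≤ b ^ γ := (le_max_left _ _).trans (Real.self_le_rpow_of_one_le hb hγ)
    calc κ * (n * (1 / (4 * J)) ^ γ) ≤ k * (n * (b⁻¹ * s⁻¹) ^ γ) := by gcongr
      _ = k * (b ^ γ)⁻¹ := by
        rw [Real.mul_rpow (by positivity) (by positivity), Real.inv_rpow hb₀.le,
          Real.inv_rpow hs₀.le, hsγ]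
        field_simp
      _ ≤ b ^ γ * (b ^ γ)⁻¹ := by gcongr
      _ = 1 := mul_inv_cancel₀ (by positivity)
  · have hbα : k ≤ b ^ α := by
      calc k = (k ^ (1 / α)) ^ α := by
            rw [← Real.rpow_mul hk₀.le, one_div_mul_cancel hα.ne', Real.rpow_one]
        _ ≤ b ^ α := by gcongr; exact le_max_right _ _
    calc κ * (1 / (4 * J)) ^ α ≤ k * (b⁻¹ * 1) ^ α := by
          gcongr
          exact hρ₁.trans (by gcongr; exact inv_le_one_of_one_le₀ hs₁)
      _ = k * (b ^ α)⁻¹ := by rw [mul_one, Real.inv_rpow hb₀.le]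
      _ ≤ b ^ α * (b ^ α)⁻¹ := by gcongr
      _ = 1 := mul_inv_cancel₀ (by positivity)
  · calc (8 * b)⁻¹ ^ α * (n : ℝ) ^ (-(α / γ)) = ((8 * b)⁻¹ * s⁻¹) ^ α := by
          rw [Real.mul_rpow (by positivity) (by positivity), Real.inv_rpow hs₀.le, hs,
            ← Real.rpow_mul hn₀.le, ← Real.rpow_neg hn₀.le]
          congr 2
          ring
      _ ≤ _ := by gcongr

theorem exists_le_minimaxExcess (hd : 1 ≤ d) {α M : ℝ≥0} (hα₀ : 0 < α) (hα₁ : α ≤ 1)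
    (hM : 0 < M) :
    ∃ c : ℝ, 0 < c ∧ ∀ n : ℕ, 1 ≤ n →
      ((c * (n : ℝ) ^ (-(((d : ℝ) + 4 * (α : ℝ)) / ((d : ℝ) + 3 * (α : ℝ)))) : ℝ) : EReal) ≤
        minimaxExcess d n (holderEnvironments d α M ∩ boundedEnvironments d) := by
  let i : Fin d := ⟨0, hd⟩
  have hα : (0 : ℝ) < α := hα₀
  have hα₁' : (α : ℝ) ≤ 1 := hα₁
  have hM' : (0 : ℝ) < M := hM
  have hd' : (1 : ℝ) ≤ d := by exact_mod_cast hd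
  -- Ramp and bumps each contribute `L` to the Hölder constant, whence `M / 2`; the bound `1/2`
  -- ensures `u ≤ 1`.
  set L : ℝ := min (M / 2) (1 / 2) with hLdef
  have hL : 0 < L := by positivity
  have hLM : 2 * L ≤ M := by have := min_le_left ((M : ℝ) / 2) (1 / 2); linarith
  have hL₁ : L ≤ 1 / 2 := min_le_right _ _
  set I : ℝ := ∫ x in unitCube d, ramp i x with hI
  have hI₀ : 0 < I := integral_ramp_pos
  set v : ℝ := volume.real (Metric.ball (0 : Point d) 1) with hv
  have hv₀ : 0 < v := ENNReal.toReal_pos (Metric.measure_ball_pos volume _ one_pos).ne'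
    measure_ball_lt_top.ne
  -- The integral of a bump contributes `d + α` and the detection probability `u ^ 2` contributes `2
  -- * α`.
  set γ : ℝ := d + 3 * α with hγdef
  have hγ : 1 ≤ γ := by linarith
  obtain ⟨c₀, hc₀, hgrid⟩ := exists_grid_size hα hγ (10 * v / I)
  have hhalf : ((1 : ℝ) / 2) ^ (α : ℝ) < 1 := Real.rpow_lt_one (by norm_num) (by norm_num) hα
  set β : ℝ := 1 - (1 / 2) ^ (α : ℝ) with hβ
  have hβ₀ : 0 < β := by linarith
  refine ⟨L * β * (1 / 8) ^ d * v * (L * I) / 10 * c₀, by positivity, fun n hn => ?_⟩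
  have hn₀ : (0 : ℝ) < n := by exact_mod_cast hn
  obtain ⟨J, hJ, h1, h2, h3⟩ := hgrid n hn
  have hJ₀ : (0 : ℝ) < J := by exact_mod_cast hJ
  have hJ₁ : (1 : ℝ) ≤ J := by exact_mod_cast hJ
  set ρ : ℝ := 1 / (4 * J) with hρdef
  have hρ : 0 < ρ := by positivity
  have hρ₁ : ρ ≤ 1 := by
    rw [hρdef, div_le_one (by positivity)]
    linarith
  have hm₁ : ρ ^ (α : ℝ) ≤ 1 := Real.rpow_le_one hρ.le hρ₁ hα.le
  have hm₀ : 0 < ρ ^ (α : ℝ) := by positivity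
  have hc : IsCellFamily i ρ (gridCenter (d := d) J) := isCellFamily_gridCenter i hJ
  -- The smallest value for which `L * ρ ^ α ≤ u / 2`, as bounded observations require; a small `u`
  -- makes bumps hard to detect.
  set u : ℝ := 2 * (L * ρ ^ (α : ℝ)) with hu
  have hu₀ : 0 < u := by positivity
  have hu₁ : u ≤ 1 := by
    have : L * ρ ^ (α : ℝ) ≤ 1 / 2 * 1 := by gcongr
    linarith
  set Φ : ℝ := ∫ x, bump α ρ (0 : Point d) x with hΦ
  have hΦ_le : Φ ≤ ρ ^ (α : ℝ) * ρ ^ d * v := integral_bump_le hd hα hρ.le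
  have hΦ_ge : β * ρ ^ (α : ℝ) * (ρ / 2) ^ d * v ≤ Φ := le_integral_bump hd hα hρ.le
  have hcard : (Fintype.card (Fin d → Fin J) : ℝ) = (J : ℝ) ^ d := by simp
  -- The cells fill a fixed proportion of the cube, so all the bumps together have integral of order
  -- `ρ ^ α`.
  have hJρ : (J : ℝ) ^ d * ρ ^ d = (1 / 4) ^ d := by
    rw [← mul_pow, hρdef]
    congr 1
    field_simp
  have hJρ' : (J : ℝ) ^ d * (ρ / 2) ^ d = (1 / 8) ^ d := by
    rw [← mul_pow, hρdef]
    congr 1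
    field_simp
    norm_num
  have hργ : ρ ^ γ = ρ ^ d * (ρ ^ (α : ℝ)) ^ 3 := by
    rw [hγdef, Real.rpow_add hρ, Real.rpow_natCast, mul_comm (3 : ℝ), Real.rpow_mul hρ.le]
    norm_num
  have hdetect : 8 / 5 * (L * Φ) * u ^ 2 ≤ L * I / n := by
    have h1' : 10 * v * (n * ρ ^ γ) ≤ I := by
      rw [div_mul_eq_mul_div, div_le_one hI₀] at h1
      exact h1
    rw [le_div_iff₀ hn₀]
    calc 8 / 5 * (L * Φ) * u ^ 2 * n
        ≤ 8 / 5 * (L * (ρ ^ (α : ℝ) * ρ ^ d * v)) * u ^ 2 * n := by gcongr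
      _ = L * (32 / 5 * L ^ 2 * (v * (n * ρ ^ γ))) := by rw [hργ, hu]; ring
      _ ≤ L * (32 / 5 * (1 / 2) ^ 2 * (v * (n * ρ ^ γ))) := by gcongr
      _ ≤ L * I := by
        gcongr
        have : 0 ≤ v * (n * ρ ^ γ) := by positivity
        linarith
  have hsize : (Fintype.card (Fin d → Fin J) : ℝ) * (L * Φ) ≤ L * I / 10 := by
    have h2' : 10 * v * ρ ^ (α : ℝ) ≤ I := by
      rw [div_mul_eq_mul_div, div_le_one hI₀] at h2
      exact h2
    rw [hcard]
    calc (J : ℝ) ^ d * (L * Φ) ≤ (J : ℝ) ^ d * (L * (ρ ^ (α : ℝ) * ρ ^ d * v)) := by gcongr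
      _ = L * ((v * ρ ^ (α : ℝ)) * ((J : ℝ) ^ d * ρ ^ d)) := by ring
      _ ≤ L * ((v * ρ ^ (α : ℝ)) * 1) := by
        rw [hJρ]
        gcongr
        exact pow_le_one₀ (by norm_num) (by norm_num)
      _ ≤ L * (I / 10) := by gcongr; linarith
      _ = _ := by ring
  have hfinal : L * β * (1 / 8) ^ d * v * (L * I) / 10 * c₀ *
      (n : ℝ) ^ (-(((d : ℝ) + 4 * (α : ℝ)) / γ)) ≤
      Fintype.card (Fin d → Fin J) * (L * Φ) * (L * I) / (10 * n) := by
    have hexp : (n : ℝ) ^ (-(((d : ℝ) + 4 * (α : ℝ)) / γ)) =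
        (n : ℝ) ^ (-((α : ℝ) / γ)) * (n : ℝ)⁻¹ := by
      rw [← Real.rpow_neg_one, ← Real.rpow_add hn₀]
      congr 1
      have : γ ≠ 0 := by positivity
      field_simp
      rw [hγdef]
      ring
    rw [hexp, hcard]
    calc _ = L * β * (1 / 8) ^ d * v * (L * I) / 10 * (c₀ * (n : ℝ) ^ (-((α : ℝ) / γ))) *
          (n : ℝ)⁻¹ := by ring
      _ ≤ L * β * (1 / 8) ^ d * v * (L * I) / 10 * ρ ^ (α : ℝ) * (n : ℝ)⁻¹ := by gcongr
      _ = (J : ℝ) ^ d * (L * (β * ρ ^ (α : ℝ) * (ρ / 2) ^ d * v)) * (L * I) / (10 * n) := by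
        rw [← hJρ']
        field_simp
      _ ≤ _ := by gcongr
  refine le_iInf fun A => ?_
  obtain ⟨ξ, hξ⟩ := hc.exists_le_excess hα hL hu₀ hu₁ A hn rfl rfl hdetect hsize
  refine le_trans (EReal.coe_le_coe_iff.2 hfinal) (hξ.trans (le_iSup₂_of_le _ ⟨?_, ?_⟩ le_rfl))
  · exact hc.mem_holderEnvironments hα₀ hα₁ hL.le hLM hu₀ hu₁
  · exact hc.mem_boundedEnvironments hα hL.le (hL₁.trans (by norm_num)) hu₀ hu₁ (by rw [hu]; linarith)

end StratifiedSampling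

end

theorem mainTheorem4 (d : ℕ) (hd : 1 ≤ d) (α M : NNReal) (hα₀ : 0 < α) (hα₁ : α ≤ 1) (hM : 0 < M) :
    ∃ c : ℝ, 0 < c ∧ ∀ n : ℕ, 1 ≤ n →
      ((c * (n : ℝ) ^ (-(((d : ℝ) + 4 * (α : ℝ)) / ((d : ℝ) + 3 * (α : ℝ)))) : ℝ) : EReal) ≤
          StratifiedSampling.minimaxExcess d n (StratifiedSampling.holderEnvironments d α M) ∧
      ((c * (n : ℝ) ^ (-(((d : ℝ) + 4 * (α : ℝ)) / ((d : ℝ) + 3 * (α : ℝ)))) : ℝ) : EReal) ≤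
          StratifiedSampling.minimaxExcess d n
            (StratifiedSampling.holderEnvironments d α M ∩
              StratifiedSampling.boundedEnvironments d) := by
  obtain ⟨c, hc, h⟩ := StratifiedSampling.exists_le_minimaxExcess hd hα₀ hα₁ hM
  refine ⟨c, hc, fun n hn => ⟨(h n hn).trans ?_, h n hn⟩⟩
  -- The hard environments are bounded, so the supremum over the larger class inherits the bound.
  exact iInf_mono fun A => biSup_mono fun e he => he.1
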